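/- **Setting.** Let $G=(V,E)$ be a directed graph with source $s$, sink $t$ and continuous non-decreasing edge costs $l_e:\mathbb R_{\ge 0}\to\mathbb R_{\ge 0}$. For $q\ge 0$, a feasible flow for the demand rate $q$ is a vector $x\in\mathbb R_{\ge 0}^{E}$ whose inflow minus outflow is $q$ at $t$, $-q$ at $s$, and $0$ at all other vertices. The length of a path $P$ is $l_P(x)=\sum_{e\in P}l_e(x_e)$, and $P$ (or a cycle) is flow-carrying if $x_e>0$ on all its edges. A feasible flow $x$ is a Wardrop equilibrium if no directed cycle is flow-carrying and $l_P(x)\le l_Q(x)$ for all simple directed $s$-$t$-paths $P,Q$ with $P$ flow-carrying. Its support set is $S(x)=\{e\in E: x_e>0\}$. For an integer $j\ge 1$, the $j$-th nested Braess network $\mathcal B^{(j)}$ has vertices $s=v_0,v_1,\dots,v_{2j},v_{2j+1}=t$ and the following edges and costs: - $(v_i,v_{i+1})$ for $0\le i\le 2j$, $i\ne j$, with cost $l_e(x)=x$; - $(v_i,v_{2j-i})$ for $0\le i\le j-1$, with constant cost $10^{\,j-1-i}$; - $(v_{i+1},v_{2j+1-i})$ for $0\le i\le j-1$, with constant cost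 $10^{\,j-1-i}$; - $(v_j,v_{j+1})$, with constant cost $0$. **Lemma.** Let $j\ge 1$. 1. $\mathcal B^{(j)}$ has $2j+2$ vertices and $4j+1$ edges. 2. For every demand rate $q\ge 0$ there is exactly one Wardrop equilibrium $x(q)$ in $\mathcal B^{(j)}$. 3. There are $2^{j+1}$ different demand rates $q_1,\dots,q_{2^{j+1}}\in[0,3\cdot 10^{\,j-1})$ such that the support sets of the Wardrop equilibria for $q_1,\dots,q_{2^{j+1}}$ are pairwise different. 4. The function $q\mapsto x(q)$ is piecewise linear on $[0,\infty)$: there are breakpoints $0=\lambda_1<\dots<\lambda_K$ and vectors $M_i,N_i$ with $x(q)=qM_i+N_i$ for $q\in[\lambda_i,\lambda_{i+1}]$, where $\lambda_{K+1}=\infty$ and the last interval is $[\lambda_K,\infty)$. Every such representation has $K\ge 2^{j+1}-1$ parts. Hence the output of the parametric equilibrium computation can be exponential in the size of the network: there is a constant $c>1$ such that, for every $j\ge 1$, every such representation of the equilibrium function of $\mathcal B^{(j)}$ has at least $c^{\,|V|+|E|}$ parts. -/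

import Mathlib

/-- A directed single-commodity network on the vertex set `V`, without parallel edges. -/
structure DirectedNetwork (V : Type) where
  edges : Finset (V × V)
  cost : V × V → ℝ → ℝ
  source : V
  target : V

namespace DirectedNetwork

variable {V : Type}

/-- Simple directed path from the source to the target, given by its list of vertices. -/
def IsPath (N : DirectedNetwork V) (p : List V) : Prop :=
  p.head? = some N.source ∧ p.getLast? = some N.target ∧ p.Nodup ∧
    p.IsChain (fun u v => (u, v) ∈ N.edges)

/-- Simple directed cycle, given by its list of vertices in which the first vertex is
repeated at the end. -/
def IsCycle (N : DirectedNetwork V) (c : List V) : Prop :=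
  2 ≤ c.length ∧ c.head? = c.getLast? ∧ c.tail.Nodup ∧
    c.IsChain (fun u v => (u, v) ∈ N.edges)

/-- The list of edges traversed by a list of vertices. -/
def stepsOf (p : List V) : List (V × V) := p.zip p.tail

/-- All edges of the path or cycle `p` have positive flow. -/
def FlowCarrying (x : V × V → ℝ) (p : List V) : Prop :=
  ∀ e ∈ stepsOf p, 0 < x e

/-- The length of a path with respect to the flow `x`. -/
def pathCost (N : DirectedNetwork V) (x : V × V → ℝ) (p : List V) : ℝ :=
  ((stepsOf p).map (fun e => N.cost e (x e))).sum

/-- Feasible directed flow for the demand rate `q`. A vector in `ℝ^E` is represented by a function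
on all pairs of vertices that vanishes outside the edge set. The excess (inflow minus outflow) is
`q` at the target, `-q` at the source and `0` at all other vertices. -/
structure IsFeasible [DecidableEq V] (N : DirectedNetwork V) (q : ℝ) (x : V × V → ℝ) : Prop where
  eq_zero : ∀ e, e ∉ N.edges → x e = 0
  nonneg : ∀ e ∈ N.edges, 0 ≤ x e
  excess : ∀ v, (∑ e ∈ N.edges with e.2 = v, x e) - (∑ e ∈ N.edges with e.1 = v, x e) =
    (if v = N.target then q else 0) - (if v = N.source then q else 0)

/-- Wardrop equilibrium for the demand rate `q`. -/
structure IsWardropEquilibrium [DecidableEq V] (N : DirectedNetwork V) (q : ℝ)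
    (x : V × V → ℝ) : Prop where
  feasible : N.IsFeasible q x
  no_cycle : ∀ c, N.IsCycle c → ¬ FlowCarrying x c
  path_le : ∀ P Q, N.IsPath P → N.IsPath Q → FlowCarrying x P → N.pathCost x P ≤ N.pathCost x Q

/-- The support set of a flow: the edges with positive flow. -/
def flowSupport (N : DirectedNetwork V) (x : V × V → ℝ) : Set (V × V) :=
  {e | e ∈ N.edges ∧ 0 < x e}

/-- `f` is a solution of the parametrized equilibrium problem: `f q` is a Wardrop equilibrium
for every demand rate `q ≥ 0`. -/
def IsEquilibriumFunction [DecidableEq V] (N : DirectedNetwork V)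
    (f : ℝ → V × V → ℝ) : Prop :=
  ∀ q, 0 ≤ q → N.IsWardropEquilibrium q (f q)

end DirectedNetwork

/-- `B` is the set of breakpoints `0 = λ₁ < λ₂ < ⋯ < λ_K` of a piecewise linear representation of
`f` on `[0, ∞)`: between consecutive breakpoints, and beyond the last one, `f q = q M + N` for some
vectors `M` and `N`. The number of function parts of the representation is `K = B.card`. -/
structure IsBreakpointSet {ι : Type} (f : ℝ → ι → ℝ) (B : Finset ℝ) : Prop where
  zero_mem : 0 ∈ B
  nonneg : ∀ b ∈ B, 0 ≤ b
  affine : ∀ a b, 0 ≤ a → a ≤ b → (∀ t ∈ B, t ∉ Set.Ioo a b) →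
    ∃ M N : ι → ℝ, ∀ q ∈ Set.Icc a b, f q = q • M + N

namespace NestedBraess

/-- The vertices `s = v_0, v_1, …, v_{2j+1} = t`. -/
abbrev Vertex (j : ℕ) : Type := Fin (2 * j + 2)

/-- The edges `(v_i, v_{i+1})` with `0 ≤ i ≤ 2j` and `i ≠ j`. -/
def E₁ (j : ℕ) : Finset (Vertex j × Vertex j) :=
  {e | (e.2 : ℕ) = (e.1 : ℕ) + 1 ∧ (e.1 : ℕ) ≠ j}

/-- The edges `(v_i, v_{2j-i})` with `0 ≤ i ≤ j - 1`. -/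
def E₂ (j : ℕ) : Finset (Vertex j × Vertex j) :=
  {e | (e.1 : ℕ) < j ∧ (e.1 : ℕ) + (e.2 : ℕ) = 2 * j}

/-- The edges `(v_{i+1}, v_{2j+1-i})` with `0 ≤ i ≤ j - 1`. -/
def E₃ (j : ℕ) : Finset (Vertex j × Vertex j) :=
  {e | 1 ≤ (e.1 : ℕ) ∧ (e.1 : ℕ) ≤ j ∧ (e.1 : ℕ) + (e.2 : ℕ) = 2 * j + 2}

/-- The middle edge `(v_j, v_{j+1})`. -/
def middle (j : ℕ) : Finset (Vertex j × Vertex j) :=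
  {e | (e.1 : ℕ) = j ∧ (e.2 : ℕ) = j + 1}

def slope (j : ℕ) (e : Vertex j × Vertex j) : ℝ := if e ∈ E₁ j then 1 else 0

/-- The constant `10^(j-1-i)` on both `(v_i, v_{2j-i})` and `(v_{i+1}, v_{2j+1-i})`, for
`0 ≤ i ≤ j - 1`, and `0` on all other edges. -/
def offset (j : ℕ) (e : Vertex j × Vertex j) : ℝ :=
  if e ∈ E₂ j then 10 ^ (j - 1 - (e.1 : ℕ))
  else if e ∈ E₃ j then 10 ^ (j - 1 - ((e.1 : ℕ) - 1))
  else 0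

end NestedBraess

open NestedBraess in
/-- The `j`-th nested Braess network. -/
noncomputable def nestedBraess (j : ℕ) : DirectedNetwork (NestedBraess.Vertex j) where
  edges := E₁ j ∪ E₂ j ∪ E₃ j ∪ middle j
  cost e x := slope j e * x + offset j e
  source := 0
  target := Fin.last (2 * j + 1)

namespace DirectedNetwork

variable {V : Type}

/-- `π` certifies that every edge carrying flow lies on shortest paths only. -/
structure IsPotential (N : DirectedNetwork V) (x : V × V → ℝ) (π : V → ℝ) : Prop where
  le : ∀ e ∈ N.edges, π e.2 ≤ π e.1 + N.cost e (x e)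
  tight : ∀ e ∈ N.edges, 0 < x e → π e.1 + N.cost e (x e) = π e.2

/-! ### Potentials and monotonicity -/

section Flows

variable [DecidableEq V] {N : DirectedNetwork V} {q r : ℝ} {x y : V × V → ℝ}

theorem IsFeasible.nonneg' (h : N.IsFeasible q x) (e : V × V) : 0 ≤ x e := by
  by_cases he : e ∈ N.edges
  · exact h.nonneg e he
  · exact (h.eq_zero e he).ge

theorem IsFeasible.mem_edges (h : N.IsFeasible q x) {e : V × V} (he : 0 < x e) : e ∈ N.edges := by
  by_contra hn
  exact he.ne' (h.eq_zero e hn)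

variable [Fintype V]

theorem sum_into (hx : ∀ e, e ∉ N.edges → x e = 0) (v : V) :
    ∑ e ∈ N.edges with e.2 = v, x e = ∑ u, x (u, v) := by
  rw [Finset.sum_filter, Finset.sum_subset (Finset.subset_univ _), Fintype.sum_prod_type]
  · simp
  · intro e _ he
    simp [hx e he]

theorem sum_out_of (hx : ∀ e, e ∉ N.edges → x e = 0) (v : V) :
    ∑ e ∈ N.edges with e.1 = v, x e = ∑ u, x (v, u) := by
  rw [Finset.sum_filter, Finset.sum_subset (Finset.subset_univ _), Fintype.sum_prod_type_right]
  · simp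
  · intro e _ he
    simp [hx e he]

theorem IsFeasible.balance (h : N.IsFeasible q x) (v : V) :
    (∑ u, x (u, v)) - ∑ u, x (v, u) =
      (if v = N.target then q else 0) - (if v = N.source then q else 0) := by
  rw [← h.excess v, sum_into h.eq_zero, sum_out_of h.eq_zero]

theorem IsFeasible.of_balance (hz : ∀ e, e ∉ N.edges → x e = 0) (hn : ∀ e, 0 ≤ x e)
    (hb : ∀ v, (∑ u, x (u, v)) - ∑ u, x (v, u) =
      (if v = N.target then q else 0) - (if v = N.source then q else 0)) : N.IsFeasible q x where
  eq_zero := hz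
  nonneg e _ := hn e
  excess v := by rw [← hb v, sum_into hz, sum_out_of hz]

/-- Summation by parts: regrouping at vertices leaves only the excesses at source and target. -/
theorem IsFeasible.sum_potential_mul (h : N.IsFeasible q x) (π : V → ℝ) :
    ∑ e ∈ N.edges, (π e.2 - π e.1) * x e = q * (π N.target - π N.source) := by
  have h1 : ∑ e ∈ N.edges, (π e.2 - π e.1) * x e = ∑ e, (π e.2 - π e.1) * x e := by
    refine Finset.sum_subset (Finset.subset_univ _) fun e _ he => ?_
    simp [h.eq_zero e he]
  have h2 : ∑ e, (π e.2 - π e.1) * x e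
      = ∑ v, π v * ((∑ u, x (u, v)) - ∑ u, x (v, u)) := by
    simp only [sub_mul, mul_sub, Finset.sum_sub_distrib, Finset.mul_sum]
    rw [Fintype.sum_prod_type_right, Fintype.sum_prod_type]
  rw [h1, h2]
  simp only [h.balance, mul_sub, Finset.sum_sub_distrib, mul_ite, mul_zero, Finset.sum_ite_eq',
    Finset.mem_univ, if_true]
  ring

theorem IsPotential.sum_cost_sub_mul_sub_le {π ρ : V → ℝ} (hx : N.IsFeasible q x)
    (hy : N.IsFeasible r y) (hπ : N.IsPotential x π) (hρ : N.IsPotential y ρ) :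
    ∑ e ∈ N.edges, (N.cost e (x e) - N.cost e (y e)) * (x e - y e) ≤
      (q - r) * ((π N.target - π N.source) - (ρ N.target - ρ N.source)) := by
  -- Complementary slackness: cost equals potential difference where `x` is positive, and is at
  -- least that where only `y` can be.
  have key : ∀ (x y : V × V → ℝ) (π : V → ℝ), N.IsPotential x π → (∀ e, 0 ≤ x e) →
      (∀ e, 0 ≤ y e) → ∀ e ∈ N.edges,
        N.cost e (x e) * (x e - y e) ≤ (π e.2 - π e.1) * (x e - y e) := by
    intro x y π hπ hx hy e he
    have h1 := mul_le_mul_of_nonneg_right (hπ.le e he) (hy e)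
    rcases (hx e).eq_or_lt with h0 | h0
    · rw [← h0] at h1 ⊢
      linarith
    · have := hπ.tight e he h0
      rw [← this]
      linarith
  calc _ ≤ ∑ e ∈ N.edges, (((π e.2 - π e.1) * x e - (π e.2 - π e.1) * y e)
            - ((ρ e.2 - ρ e.1) * x e - (ρ e.2 - ρ e.1) * y e)) := by
        refine Finset.sum_le_sum fun e he => ?_
        have h1 := key x y π hπ hx.nonneg' hy.nonneg' e he
        have h2 := key y x ρ hρ hy.nonneg' hx.nonneg' e he
        linarith
    _ = _ := by
        simp only [Finset.sum_sub_distrib, hx.sum_potential_mul, hy.sum_potential_mul]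
        ring

end Flows

/-! ### Walks and their lengths -/

section Walks

variable {N : DirectedNetwork V} {x : V × V → ℝ} {π : V → ℝ}

/-- A directed walk from `u` to `v`, given by its list of vertices. -/
def IsWalk (N : DirectedNetwork V) (u v : V) (p : List V) : Prop :=
  p.head? = some u ∧ p.getLast? = some v ∧ p.IsChain (fun a b => (a, b) ∈ N.edges)

theorem isWalk_singleton (v : V) : N.IsWalk v v [v] := by simp [IsWalk]

theorem stepsOf_append {u v : V} {p r : List V} (hp : p.getLast? = some u)
    (hr : r.head? = some v) : stepsOf (p ++ r) = stepsOf p ++ (u, v) :: stepsOf r := by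
  induction p with
  | nil => simp at hp
  | cons a p ih =>
    cases p with
    | nil =>
      cases r with
      | nil => simp at hr
      | cons b r => simp_all [stepsOf]
    | cons b p =>
      have := ih (by simpa using hp)
      simpa [stepsOf] using this

theorem IsWalk.append {s u v t : V} {p r : List V} (hp : N.IsWalk s u p) (hr : N.IsWalk v t r)
    (he : (u, v) ∈ N.edges) : N.IsWalk s t (p ++ r) := by
  obtain ⟨hp1, hp2, hp3⟩ := hp
  obtain ⟨hr1, hr2, hr3⟩ := hr
  refine ⟨by simp [List.head?_append, hp1], by simp [List.getLast?_append, hr2], ?_⟩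
  rw [List.isChain_append]
  refine ⟨hp3, hr3, fun a ha b hb => ?_⟩
  simp_all

theorem IsWalk.pathCost_append {s u v t : V} {p r : List V} (hp : N.IsWalk s u p)
    (hr : N.IsWalk v t r) :
    N.pathCost x (p ++ r) = N.pathCost x p + N.cost (u, v) (x (u, v)) + N.pathCost x r := by
  simp [pathCost, stepsOf_append hp.2.1 hr.1, add_assoc]

theorem IsWalk.flowCarrying_append {s u v t : V} {p r : List V} (hp : N.IsWalk s u p)
    (hr : N.IsWalk v t r) (hpx : FlowCarrying x p) (hrx : FlowCarrying x r) (he : 0 < x (u, v)) :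
    FlowCarrying x (p ++ r) := by
  intro e h
  rw [stepsOf_append hp.2.1 hr.1] at h
  simp only [List.mem_append, List.mem_cons] at h
  rcases h with h | rfl | h
  exacts [hpx e h, he, hrx e h]

theorem IsWalk.exists_concat {s u t : V} {p r : List V} (hp : N.IsWalk s u p)
    (hr : N.IsWalk u t r) :
    ∃ m, N.IsWalk s t m ∧ N.pathCost x m = N.pathCost x p + N.pathCost x r := by
  cases r with
  | nil => simp [IsWalk] at hr
  | cons a r =>
    obtain ⟨h1, h2, h3⟩ := hr
    obtain rfl : a = u := by simpa using h1
    cases r with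
    | nil =>
      obtain rfl : a = t := by simpa using h2
      exact ⟨p, hp, by simp [pathCost, stepsOf]⟩
    | cons b r =>
      have hr' : N.IsWalk b t (b :: r) := ⟨rfl, by simpa using h2, h3.tail⟩
      refine ⟨p ++ b :: r, hp.append hr' h3.rel, ?_⟩
      rw [hp.pathCost_append hr']
      simp [pathCost, stepsOf, add_assoc]

theorem IsPotential.le_pathCost (hπ : N.IsPotential x π) {u v : V} {p : List V}
    (hp : N.IsWalk u v p) : π v - π u ≤ N.pathCost x p := by
  induction p generalizing u with
  | nil => simp [IsWalk] at hp
  | cons a p ih =>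
    obtain ⟨h1, h2, h3⟩ := hp
    cases p with
    | nil => simp_all [pathCost, stepsOf]
    | cons b p =>
      have h := ih (u := b) ⟨rfl, by simpa using h2, h3.tail⟩
      have he := hπ.le (a, b) (by simpa using h3.rel)
      simp only [List.head?_cons, Option.some.injEq] at h1
      subst h1
      simp only [pathCost, stepsOf, List.tail_cons, List.zip_cons_cons, List.map_cons,
        List.sum_cons] at h he ⊢
      linarith

theorem IsPotential.pathCost_eq (hπ : N.IsPotential x π) {u v : V} {p : List V}
    (hp : N.IsWalk u v p) (hpx : FlowCarrying x p) : N.pathCost x p = π v - π u := by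
  induction p generalizing u with
  | nil => simp [IsWalk] at hp
  | cons a p ih =>
    obtain ⟨h1, h2, h3⟩ := hp
    cases p with
    | nil => simp_all [pathCost, stepsOf]
    | cons b p =>
      have h := ih (u := b) ⟨rfl, by simpa using h2, h3.tail⟩
        (fun e he => hpx e (by simpa [stepsOf] using Or.inr he))
      have he := hπ.tight (a, b) (by simpa using h3.rel) (hpx _ (by simp [stepsOf]))
      simp only [List.head?_cons, Option.some.injEq] at h1
      subst h1
      simp only [pathCost, stepsOf, List.tail_cons, List.zip_cons_cons, List.map_cons,
        List.sum_cons] at h he ⊢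
      linarith

end Walks

/-! ### Equilibria and potentials in acyclic networks -/

section Acyclic

variable {n : ℕ} {N : DirectedNetwork (Fin (n + 1))} {q : ℝ} {x : Fin (n + 1) × Fin (n + 1) → ℝ}

theorem pairwise_lt_of_isChain (hN : ∀ e ∈ N.edges, e.1 < e.2) {p : List (Fin (n + 1))}
    (hp : p.IsChain (fun a b => (a, b) ∈ N.edges)) : p.Pairwise (· < ·) :=
  List.isChain_iff_pairwise.1 (hp.imp fun a b h => hN (a, b) h)

theorem IsWalk.nodup (hN : ∀ e ∈ N.edges, e.1 < e.2) {u v : Fin (n + 1)} {p : List (Fin (n + 1))}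
    (hp : N.IsWalk u v p) : p.Nodup :=
  (pairwise_lt_of_isChain hN hp.2.2).imp fun h => h.ne

theorem IsWalk.isPath (hN : ∀ e ∈ N.edges, e.1 < e.2) {p : List (Fin (n + 1))}
    (hp : N.IsWalk N.source N.target p) : N.IsPath p :=
  ⟨hp.1, hp.2.1, hp.nodup hN, hp.2.2⟩

theorem not_isCycle (hN : ∀ e ∈ N.edges, e.1 < e.2) (c : List (Fin (n + 1))) : ¬ N.IsCycle c := by
  rintro ⟨h1, h2, -, h4⟩
  have := pairwise_lt_of_isChain hN h4
  match c, h1 with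
  | a :: b :: c, _ =>
    have hl : (a :: b :: c).getLast? = (b :: c).getLast? := by simp
    rw [hl] at h2
    have hm : a ∈ b :: c := List.mem_of_getLast? h2.symm
    exact lt_irrefl a (List.rel_of_pairwise_cons this hm)

theorem IsPotential.isWardropEquilibrium (hN : ∀ e ∈ N.edges, e.1 < e.2)
    {π : Fin (n + 1) → ℝ} (hx : N.IsFeasible q x) (hπ : N.IsPotential x π) :
    N.IsWardropEquilibrium q x where
  feasible := hx
  no_cycle c hc := (not_isCycle hN c hc).elim
  path_le P Q hP hQ hc := by
    rw [hπ.pathCost_eq (u := N.source) (v := N.target) ⟨hP.1, hP.2.1, hP.2.2.2⟩ hc]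
    exact hπ.le_pathCost ⟨hQ.1, hQ.2.1, hQ.2.2.2⟩

/-- Flow is traced backwards: by conservation an inner vertex with outflow has inflow, coming from a
smaller index. -/
theorem IsFeasible.exists_walk_from_source (hN : ∀ e ∈ N.edges, e.1 < e.2)
    (ht : N.target = Fin.last n) (hx : N.IsFeasible q x) (u v : Fin (n + 1))
    (he : 0 < x (u, v)) : ∃ p, N.IsWalk N.source u p ∧ FlowCarrying x p := by
  induction hu : (u : ℕ) using Nat.strong_induction_on generalizing u v with
  | _ k ih =>
  by_cases hus : u = N.source
  · exact ⟨[u], hus ▸ isWalk_singleton _, by simp [FlowCarrying, stepsOf]⟩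
  have huv : u < v := hN _ (hx.mem_edges he)
  have hut : u ≠ N.target := by
    rw [ht]
    exact (huv.trans_le (Fin.le_last v)).ne
  have hb := hx.balance u
  rw [if_neg hus, if_neg hut] at hb
  have hpos : 0 < ∑ w, x (w, u) := by
    have : x (u, v) ≤ ∑ w, x (u, w) :=
      Finset.single_le_sum (fun w _ => hx.nonneg' (u, w)) (Finset.mem_univ v)
    linarith
  obtain ⟨w, -, hw⟩ := Finset.exists_lt_of_sum_lt (s := Finset.univ) (f := fun _ => (0 : ℝ))
    (g := fun w => x (w, u)) (by simpa using hpos)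
  have hm := hx.mem_edges hw
  have hwu : w < u := hN _ hm
  obtain ⟨p, hp, hpx⟩ := ih w (by omega) w u hw rfl
  exact ⟨p ++ [u], hp.append (isWalk_singleton u) hm,
    hp.flowCarrying_append (isWalk_singleton u) hpx (by simp [FlowCarrying, stepsOf]) hw⟩

theorem IsFeasible.exists_walk_to_target (hN : ∀ e ∈ N.edges, e.1 < e.2)
    (hs : N.source = 0) (hx : N.IsFeasible q x) (u v : Fin (n + 1))
    (he : 0 < x (u, v)) : ∃ p, N.IsWalk v N.target p ∧ FlowCarrying x p := by
  induction hk : n - (v : ℕ) using Nat.strong_induction_on generalizing u v with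
  | _ k ih =>
  by_cases hvt : v = N.target
  · exact ⟨[v], hvt ▸ isWalk_singleton _, by simp [FlowCarrying, stepsOf]⟩
  have huv : u < v := hN _ (hx.mem_edges he)
  have hvs : v ≠ N.source := by
    rw [hs]
    exact ((Fin.zero_le u).trans_lt huv).ne'
  have hb := hx.balance v
  rw [if_neg hvs, if_neg hvt] at hb
  have hpos : 0 < ∑ w, x (v, w) := by
    have : x (u, v) ≤ ∑ w, x (w, v) :=
      Finset.single_le_sum (fun w _ => hx.nonneg' (w, v)) (Finset.mem_univ u)
    linarith
  obtain ⟨w, -, hw⟩ := Finset.exists_lt_of_sum_lt (s := Finset.univ) (f := fun _ => (0 : ℝ))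
    (g := fun w => x (v, w)) (by simpa using hpos)
  have hm := hx.mem_edges hw
  have hvw : v < w := hN _ hm
  obtain ⟨p, hp, hpx⟩ := ih (n - w) (by omega) v w hw rfl
  exact ⟨[v] ++ p, (isWalk_singleton v).append hp hm,
    (isWalk_singleton v).flowCarrying_append hp (by simp [FlowCarrying, stepsOf]) hpx hw⟩

/-- The potential is the distance from the source. If an edge carrying flow were not tight, a
flow-carrying path through it could be shortened by replacing its initial part with a shortest walk
to the head of the edge. -/
theorem IsWardropEquilibrium.exists_isPotential (hN : ∀ e ∈ N.edges, e.1 < e.2)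
    (hs : N.source = 0) (ht : N.target = Fin.last n)
    (hstep : ∀ i : Fin n, (i.castSucc, i.succ) ∈ N.edges)
    (hx : N.IsWardropEquilibrium q x) : ∃ π, N.IsPotential x π := by
  have hwalk : ∀ v, ∃ p, N.IsWalk N.source v p := by
    intro v
    induction v using Fin.induction with
    | zero => exact ⟨[0], hs ▸ isWalk_singleton _⟩
    | succ i ih =>
      obtain ⟨p, hp⟩ := ih
      exact ⟨p ++ [i.succ], hp.append (isWalk_singleton _) (hstep i)⟩
  have hmin : ∀ v, ∃ p, N.IsWalk N.source v p ∧
      ∀ r, N.IsWalk N.source v r → N.pathCost x p ≤ N.pathCost x r := by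
    intro v
    -- Walks repeat no vertex, so there are finitely many and the minimum is attained.
    have hfin : {p | N.IsWalk N.source v p}.Finite :=
      (List.finite_length_le (Fin (n + 1)) (Fintype.card (Fin (n + 1)))).subset
        fun p hp => (IsWalk.nodup hN hp).length_le_card
    exact Set.exists_min_image _ _ hfin (hwalk v)
  choose P hP hPmin using hmin
  refine ⟨fun v => N.pathCost x (P v), fun e he => ?_, fun e he hpos => ?_⟩
  · have h := hPmin e.2 _ ((hP e.1).append (isWalk_singleton e.2) he)
    rw [(hP e.1).pathCost_append (isWalk_singleton e.2)] at h
    simpa [pathCost, stepsOf] using h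
  · have hf := hx.feasible
    obtain ⟨p, hp, hpx⟩ := hf.exists_walk_from_source hN ht e.1 e.2 hpos
    obtain ⟨r, hr, hrx⟩ := hf.exists_walk_to_target hN hs e.1 e.2 hpos
    have h1 := hPmin e.1 p hp
    have h2 := hPmin e.2 _ ((hP e.1).append (isWalk_singleton e.2) he)
    rw [(hP e.1).pathCost_append (isWalk_singleton e.2)] at h2
    obtain ⟨m, hm, hmc⟩ := (hP e.2).exists_concat (x := x) hr
    have h3 := hx.path_le (p ++ r) m ((hp.append hr he).isPath hN) (hm.isPath hN)
      (hp.flowCarrying_append hr hpx hrx hpos)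
    rw [hp.pathCost_append hr, hmc] at h3
    have h4 : N.pathCost x [e.2] = 0 := by simp [pathCost, stepsOf]
    simp only [Prod.mk.eta] at h2 h3 ⊢
    linarith

end Acyclic

end DirectedNetwork

/-! ### Recursive structure of the nested networks -/

namespace NestedBraess

open DirectedNetwork

section Frame

variable {j : ℕ}

/-- The embedding of the vertices of the `j`-th network as inner vertices of the next one. -/
def shift (v : Vertex j) : Vertex (j + 1) := ⟨(v : ℕ) + 1, by omega⟩

@[simp] theorem val_shift (v : Vertex j) : (shift v : ℕ) = (v : ℕ) + 1 := rfl

theorem shift_injective : Function.Injective (shift (j := j)) := by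
  intro u v h
  have := congrArg Fin.val h
  simp only [val_shift] at this
  exact Fin.ext (by omega)

@[simp] theorem shift_inj {u v : Vertex j} : shift u = shift v ↔ u = v := shift_injective.eq_iff

@[simp] theorem shift_ne_zero (v : Vertex j) : shift v ≠ 0 :=
  fun h => Nat.succ_ne_zero _ (congrArg Fin.val h)

@[simp] theorem shift_ne_last (v : Vertex j) : shift v ≠ Fin.last (2 * (j + 1) + 1) := by
  have := v.isLt
  simp only [ne_eq, Fin.ext_iff, val_shift, Fin.val_last]
  omega

@[simp] theorem zero_ne_shift (v : Vertex j) : 0 ≠ shift v := (shift_ne_zero v).symm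

@[simp] theorem last_ne_shift (v : Vertex j) : Fin.last (2 * (j + 1) + 1) ≠ shift v :=
  (shift_ne_last v).symm

@[simp] theorem zero_ne_last : (0 : Vertex j) ≠ Fin.last (2 * j + 1) := by
  simp [Fin.ext_iff]

@[simp] theorem last_ne_zero : Fin.last (2 * j + 1) ≠ (0 : Vertex j) := zero_ne_last.symm

theorem forall_vertex_succ {P : Vertex (j + 1) → Prop} :
    (∀ w, P w) ↔ P 0 ∧ (∀ v, P (shift v)) ∧ P (Fin.last (2 * (j + 1) + 1)) := by
  refine ⟨fun h => ⟨h _, fun v => h _, h _⟩, fun ⟨h0, h1, h2⟩ w => ?_⟩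
  by_cases hw0 : (w : ℕ) = 0
  · have : w = 0 := Fin.ext hw0
    rwa [this]
  by_cases hwl : (w : ℕ) = 2 * (j + 1) + 1
  · have : w = Fin.last (2 * (j + 1) + 1) := Fin.ext hwl
    rwa [this]
  · have := h1 ⟨(w : ℕ) - 1, by omega⟩
    convert this using 1
    exact Fin.ext (by simp; omega)

/-- The function on the vertices of the next network with given values at the source, the inner
vertices and the target. -/
def frame {α : Type*} (a : α) (f : Vertex j → α) (b : α) (w : Vertex (j + 1)) : α :=
  if (w : ℕ) = 0 then a else if h : (w : ℕ) < 2 * j + 3 then f ⟨(w : ℕ) - 1, by omega⟩ else b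

section
variable {α : Type*} (a : α) (f : Vertex j → α) (b : α)

@[simp] theorem frame_zero : frame a f b 0 = a := rfl

@[simp] theorem frame_shift (v : Vertex j) : frame a f b (shift v) = f v := by
  have := v.isLt
  simp [frame, show (v : ℕ) + 1 < 2 * j + 3 by omega]

@[simp] theorem frame_last : frame a f b (Fin.last (2 * (j + 1) + 1)) = b := by
  simp [frame, show ¬ (2 * (j + 1) + 1 < 2 * j + 3) by omega]

end

theorem sum_vertex_succ {M : Type*} [AddCommMonoid M] (f : Vertex (j + 1) → M) :
    ∑ w, f w = f 0 + ∑ v : Vertex j, f (shift v) + f (Fin.last (2 * (j + 1) + 1)) := by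
  have h := Fin.sum_univ_castSucc (n := 2 * j + 3) f
  rw [Fin.sum_univ_succ (fun i : Fin (2 * j + 3) => f i.castSucc)] at h
  exact h

end Frame

section Edges

variable {j : ℕ}

/-- The middle edge fills the gap in `E₁`, so together they are all consecutive pairs. -/
theorem mem_edges {e : Vertex j × Vertex j} : e ∈ (nestedBraess j).edges ↔
    ((e.2 : ℕ) = (e.1 : ℕ) + 1) ∨ ((e.1 : ℕ) < j ∧ (e.1 : ℕ) + (e.2 : ℕ) = 2 * j) ∨
      (1 ≤ (e.1 : ℕ) ∧ (e.1 : ℕ) ≤ j ∧ (e.1 : ℕ) + (e.2 : ℕ) = 2 * j + 2) := by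
  simp only [nestedBraess, E₁, E₂, E₃, middle, Finset.mem_union, Finset.mem_filter,
    Finset.mem_univ, true_and]
  omega

theorem fst_lt_snd (e : Vertex j × Vertex j) (he : e ∈ (nestedBraess j).edges) : e.1 < e.2 := by
  rw [mem_edges] at he
  rw [Fin.lt_def]
  omega

@[simp] theorem source_nestedBraess : (nestedBraess j).source = 0 := rfl

@[simp] theorem target_nestedBraess : (nestedBraess j).target = Fin.last (2 * j + 1) := rfl

theorem step_mem_edges (i : Fin (2 * j + 1)) : (i.castSucc, i.succ) ∈ (nestedBraess j).edges :=
  mem_edges.2 (Or.inl (by simp))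

@[simp] theorem shift_shift_mem_edges {u v : Vertex j} :
    (shift u, shift v) ∈ (nestedBraess (j + 1)).edges ↔ (u, v) ∈ (nestedBraess j).edges := by
  simp only [mem_edges, val_shift]
  omega

@[simp] theorem zero_shift_mem_edges {v : Vertex j} :
    (0, shift v) ∈ (nestedBraess (j + 1)).edges ↔ v = 0 ∨ v = Fin.last (2 * j + 1) := by
  simp only [mem_edges, val_shift, Fin.ext_iff, Fin.val_last, Fin.val_zero]
  omega

@[simp] theorem shift_last_mem_edges {v : Vertex j} :
    (shift v, Fin.last (2 * (j + 1) + 1)) ∈ (nestedBraess (j + 1)).edges ↔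
      v = 0 ∨ v = Fin.last (2 * j + 1) := by
  have := v.isLt
  simp only [mem_edges, val_shift, Fin.ext_iff, Fin.val_last, Fin.val_zero]
  omega

@[simp] theorem mk_zero_not_mem_edges {u : Vertex j} : (u, 0) ∉ (nestedBraess j).edges :=
  fun h => (Fin.zero_le u).not_gt (fst_lt_snd _ h)

@[simp] theorem last_mk_not_mem_edges {u : Vertex j} :
    (Fin.last (2 * j + 1), u) ∉ (nestedBraess j).edges :=
  fun h => (Fin.le_last u).not_gt (fst_lt_snd _ h)

@[simp] theorem zero_last_not_mem_edges :
    (0, Fin.last (2 * (j + 1) + 1)) ∉ (nestedBraess (j + 1)).edges := by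
  simp only [mem_edges, Fin.val_last, Fin.val_zero]
  omega

theorem cost_def (e : Vertex j × Vertex j) (t : ℝ) :
    (nestedBraess j).cost e t = slope j e * t + offset j e := rfl

@[simp] theorem slope_shift_shift (u v : Vertex j) :
    slope (j + 1) (shift u, shift v) = slope j (u, v) := by
  simp only [slope, E₁, Finset.mem_filter, Finset.mem_univ, true_and, val_shift]
  congr 1
  simp

@[simp] theorem offset_shift_shift (u v : Vertex j) :
    offset (j + 1) (shift u, shift v) = offset j (u, v) := by
  simp only [offset, E₂, E₃, Finset.mem_filter, Finset.mem_univ, true_and, val_shift]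
  have h2 : ((u : ℕ) + 1 < j + 1 ∧ (u : ℕ) + 1 + ((v : ℕ) + 1) = 2 * (j + 1)) ↔
      ((u : ℕ) < j ∧ (u : ℕ) + v = 2 * j) := by omega
  by_cases h : (u : ℕ) < j ∧ (u : ℕ) + v = 2 * j
  · rw [if_pos h, if_pos (h2.2 h)]
    congr 1
    omega
  · rw [if_neg h, if_neg (mt h2.1 h)]
    -- For `u = 0` the first bound on the left is automatic, but the sum would force `v = 2j + 2`,
    -- which is out of range.
    have h3 : (1 ≤ (u : ℕ) + 1 ∧ (u : ℕ) + 1 ≤ j + 1 ∧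
        (u : ℕ) + 1 + ((v : ℕ) + 1) = 2 * (j + 1) + 2) ↔
        (1 ≤ (u : ℕ) ∧ (u : ℕ) ≤ j ∧ (u : ℕ) + v = 2 * j + 2) := by
      have := v.isLt
      omega
    by_cases h' : 1 ≤ (u : ℕ) ∧ (u : ℕ) ≤ j ∧ (u : ℕ) + v = 2 * j + 2
    · rw [if_pos h', if_pos (h3.2 h')]
      congr 1
      omega
    · rw [if_neg h', if_neg (mt h3.1 h')]

theorem cost_shift_shift (u v : Vertex j) (t : ℝ) :
    (nestedBraess (j + 1)).cost (shift u, shift v) t = (nestedBraess j).cost (u, v) t := by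
  simp [cost_def]

theorem cost_zero_shift_zero (t : ℝ) : (nestedBraess (j + 1)).cost (0, shift 0) t = t := by
  have h1 : slope (j + 1) (0, shift 0) = 1 := by simp [slope, E₁]
  have h2 : offset (j + 1) (0, shift 0) = 0 := by
    simp only [offset, E₂, E₃, Finset.mem_filter, Finset.mem_univ, true_and, val_shift,
      Fin.val_zero]
    rw [if_neg (by omega), if_neg (by omega)]
  simp [cost_def, h1, h2]

theorem cost_zero_shift_last (t : ℝ) :
    (nestedBraess (j + 1)).cost (0, shift (Fin.last (2 * j + 1))) t = 10 ^ j := by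
  have h1 : slope (j + 1) (0, shift (Fin.last (2 * j + 1))) = 0 := by simp [slope, E₁]
  have h2 : offset (j + 1) (0, shift (Fin.last (2 * j + 1))) = 10 ^ j := by
    simp only [offset, E₂, E₃, Finset.mem_filter, Finset.mem_univ, true_and, val_shift,
      Fin.val_zero, Fin.val_last]
    rw [if_pos (by omega)]
    congr 1
  simp [cost_def, h1, h2]

theorem cost_shift_zero_last (t : ℝ) :
    (nestedBraess (j + 1)).cost (shift 0, Fin.last (2 * (j + 1) + 1)) t = 10 ^ j := by
  have h1 : slope (j + 1) (shift 0, Fin.last (2 * (j + 1) + 1)) = 0 := by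
    simp only [slope, E₁, Finset.mem_filter, Finset.mem_univ, true_and, val_shift,
      Fin.val_zero, Fin.val_last]
    rw [if_neg (by omega)]
  have h2 : offset (j + 1) (shift 0, Fin.last (2 * (j + 1) + 1)) = 10 ^ j := by
    simp only [offset, E₂, E₃, Finset.mem_filter, Finset.mem_univ, true_and, val_shift,
      Fin.val_zero, Fin.val_last]
    rw [if_neg (by omega), if_pos (by omega)]
    congr 1
  simp [cost_def, h1, h2]

theorem cost_shift_last_last (t : ℝ) :
    (nestedBraess (j + 1)).cost (shift (Fin.last (2 * j + 1)), Fin.last (2 * (j + 1) + 1)) t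
      = t := by
  have h1 : slope (j + 1) (shift (Fin.last (2 * j + 1)), Fin.last (2 * (j + 1) + 1)) = 1 := by
    simp only [slope, E₁, Finset.mem_filter, Finset.mem_univ, true_and, val_shift, Fin.val_last]
    rw [if_pos (by omega)]
  have h2 : offset (j + 1) (shift (Fin.last (2 * j + 1)), Fin.last (2 * (j + 1) + 1)) = 0 := by
    simp only [offset, E₂, E₃, Finset.mem_filter, Finset.mem_univ, true_and, val_shift,
      Fin.val_last]
    rw [if_neg (by omega), if_neg (by omega)]
  simp [cost_def, h1, h2]

/-- Network 0 is a single free edge; it serves as the base case of the inductions on `j`. -/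
theorem edges_zero : (nestedBraess 0).edges = {(0, 1)} := by
  ext ⟨u, v⟩
  fin_cases u <;> fin_cases v <;> simp [mem_edges]

theorem cost_zero (e : Vertex 0 × Vertex 0) (t : ℝ) (he : e ∈ (nestedBraess 0).edges) :
    (nestedBraess 0).cost e t = 0 := by
  rw [edges_zero, Finset.mem_singleton] at he
  subst he
  simp [cost_def, slope, offset, E₁, E₂, E₃]

theorem sum_ite_zero_or_last {M : Type*} [AddCommMonoid M] (a b : M) :
    ∑ v : Vertex j, (if v = 0 then a else if v = Fin.last (2 * j + 1) then b else 0) = a + b := by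
  have : ∀ v : Vertex j, (if v = 0 then a else if v = Fin.last (2 * j + 1) then b else 0) =
      (if v = 0 then a else 0) + (if v = Fin.last (2 * j + 1) then b else 0) := by
    intro v
    by_cases h : v = 0
    · simp [h]
    · simp [h]
  simp [this, Finset.sum_add_distrib]

theorem card_edges (j : ℕ) : (nestedBraess j).edges.card = 4 * j + 1 := by
  have h : ∀ j, (nestedBraess j).edges.card =
      ∑ u, ∑ v, if (u, v) ∈ (nestedBraess j).edges then 1 else 0 := by
    intro j
    rw [← Fintype.sum_prod_type' (f := fun u v => if (u, v) ∈ (nestedBraess j).edges then 1 else 0)]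
    simp
  have h2 : ∀ j (v : Vertex j), (if v = 0 ∨ v = Fin.last (2 * j + 1) then 1 else 0) =
      if v = 0 then 1 else if v = Fin.last (2 * j + 1) then 1 else 0 := by
    intro j v
    split_ifs <;> simp_all
  induction j with
  | zero => simp [edges_zero]
  | succ j ih =>
    rw [h] at ih ⊢
    simp only [sum_vertex_succ, zero_shift_mem_edges, shift_shift_mem_edges, shift_last_mem_edges,
      mk_zero_not_mem_edges, last_mk_not_mem_edges, zero_last_not_mem_edges, if_false,
      Finset.sum_add_distrib, ih, Finset.sum_const_zero, h2, sum_ite_zero_or_last]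
    ring

end Edges


theorem forall_edges_succ {j : ℕ} {P : Vertex (j + 1) × Vertex (j + 1) → Prop} :
    (∀ e ∈ (nestedBraess (j + 1)).edges, P e) ↔
      P (0, shift 0) ∧ P (0, shift (Fin.last (2 * j + 1))) ∧
      P (shift 0, Fin.last (2 * (j + 1) + 1)) ∧
      P (shift (Fin.last (2 * j + 1)), Fin.last (2 * (j + 1) + 1)) ∧
      ∀ e ∈ (nestedBraess j).edges, P (shift e.1, shift e.2) := by
  simp only [Prod.forall, forall_vertex_succ (j := j), mk_zero_not_mem_edges,
    last_mk_not_mem_edges, zero_last_not_mem_edges, zero_shift_mem_edges, shift_last_mem_edges,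
    shift_shift_mem_edges, or_imp, forall_and, forall_eq]
  tauto

end NestedBraess

/-! ### Uniqueness and the surrounding construction -/

namespace NestedBraess

open DirectedNetwork

/-- Once the edges of linear cost are discarded, source and target each keep a single bypass edge,
which balance forces to 0. Peeling these off leaves the inner network. -/
theorem circulation_eq_zero {j : ℕ} {d : Vertex j × Vertex j → ℝ}
    (hz : ∀ e, e ∉ (nestedBraess j).edges → d e = 0)
    (hs : ∀ e, slope j e ≠ 0 → d e = 0)
    (hb : ∀ v, (∑ u, d (u, v)) - ∑ u, d (v, u) = 0) : ∀ e, d e = 0 := by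
  induction j with
  | zero =>
    intro e
    by_cases he : e ∈ (nestedBraess 0).edges
    · have h := hb 0
      rw [Finset.sum_eq_zero (fun u _ => hz _ mk_zero_not_mem_edges),
        Finset.sum_eq_single (1 : Vertex 0)] at h
      · rw [edges_zero, Finset.mem_singleton] at he
        rw [he]
        linarith
      · intro v _ hv
        refine hz _ ?_
        rw [edges_zero]
        simpa using hv
      · simp
    · exact hz e he
  | succ j ih =>
    have hs1 : d (0, shift 0) = 0 := hs _ (by simp [slope, E₁])
    have hs2 : d (shift (Fin.last (2 * j + 1)), Fin.last (2 * (j + 1) + 1)) = 0 :=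
      hs _ (by simp [slope, E₁]; omega)
    have hs3 : d (0, shift (Fin.last (2 * j + 1))) = 0 := by
      have h := hb 0
      rw [Finset.sum_eq_zero (fun u _ => hz _ mk_zero_not_mem_edges), sum_vertex_succ,
        hz _ mk_zero_not_mem_edges, hz _ zero_last_not_mem_edges,
        Finset.sum_eq_single (Fin.last (2 * j + 1))] at h
      · linarith
      · intro v _ hv
        by_cases hv0 : v = 0
        · rw [hv0, hs1]
        · exact hz _ (by simp [hv, hv0])
      · simp
    have hs4 : d (shift 0, Fin.last (2 * (j + 1) + 1)) = 0 := by
      have h := hb (Fin.last (2 * (j + 1) + 1))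
      rw [Finset.sum_eq_zero (fun u _ => hz _ last_mk_not_mem_edges), sum_vertex_succ,
        hz _ last_mk_not_mem_edges, hz _ zero_last_not_mem_edges,
        Finset.sum_eq_single (0 : Vertex j)] at h
      · linarith
      · intro v _ hv
        by_cases hv0 : v = Fin.last (2 * j + 1)
        · rw [hv0, hs2]
        · exact hz _ (by simp [hv, hv0])
      · simp
    have hzl : ∀ v, d (0, shift v) = 0 := by
      intro v
      by_cases h : v = 0 ∨ v = Fin.last (2 * j + 1)
      · rcases h with rfl | rfl <;> assumption
      · exact hz _ (by simpa using h)
    have hzr : ∀ v, d (shift v, Fin.last (2 * (j + 1) + 1)) = 0 := by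
      intro v
      by_cases h : v = 0 ∨ v = Fin.last (2 * j + 1)
      · rcases h with rfl | rfl <;> assumption
      · exact hz _ (by simpa using h)
    have hin : ∀ e : Vertex j × Vertex j, d (shift e.1, shift e.2) = 0 := by
      refine ih (d := fun e => d (shift e.1, shift e.2)) (fun e he => hz _ (by simpa using he))
        (fun e he => hs _ (by simpa using he)) fun v => ?_
      have h := hb (shift v)
      rw [sum_vertex_succ, sum_vertex_succ, hzl, hzr, hz _ mk_zero_not_mem_edges,
        hz _ last_mk_not_mem_edges] at h
      linarith
    intro e
    by_cases he : e ∈ (nestedBraess (j + 1)).edges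
    · exact forall_edges_succ (P := fun e => d e = 0).2
        ⟨hs1, hs3, hs4, hs2, fun e _ => hin e⟩ e he
    · exact hz e he

/-- `x` is an equilibrium flow for the demand rate `q`, and `l` is the length of the shortest
paths for some choice of potentials. (For `q = 0` any `l ≤ 0` can be chosen.) -/
structure IsEquilibriumWith (j : ℕ) (q l : ℝ) (x : Vertex j × Vertex j → ℝ) : Prop where
  feasible : (nestedBraess j).IsFeasible q x
  exists_potential : ∃ π, (nestedBraess j).IsPotential x π ∧ π (Fin.last (2 * j + 1)) - π 0 = l

variable {j : ℕ} {q r l m : ℝ} {x y : Vertex j × Vertex j → ℝ}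

theorem IsEquilibriumWith.isWardropEquilibrium (h : IsEquilibriumWith j q l x) :
    (nestedBraess j).IsWardropEquilibrium q x := by
  obtain ⟨hx, π, hπ, -⟩ := h
  exact hπ.isWardropEquilibrium fst_lt_snd hx

theorem exists_isEquilibriumWith (h : (nestedBraess j).IsWardropEquilibrium q x) :
    ∃ l, IsEquilibriumWith j q l x := by
  obtain ⟨π, hπ⟩ := h.exists_isPotential fst_lt_snd rfl rfl step_mem_edges
  exact ⟨_, h.feasible, π, hπ, rfl⟩

theorem slope_nonneg (e : Vertex j × Vertex j) : 0 ≤ slope j e := by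
  unfold slope
  split_ifs <;> norm_num

theorem IsEquilibriumWith.sum_le (hx : IsEquilibriumWith j q l x)
    (hy : IsEquilibriumWith j r m y) :
    ∑ e ∈ (nestedBraess j).edges, slope j e * (x e - y e) ^ 2 ≤ (q - r) * (l - m) := by
  obtain ⟨hx, π, hπ, rfl⟩ := hx
  obtain ⟨hy, ρ, hρ, rfl⟩ := hy
  refine le_trans (le_of_eq (Finset.sum_congr rfl fun e _ => ?_))
    (hπ.sum_cost_sub_mul_sub_le hx hy hρ)
  rw [cost_def, cost_def]
  ring

theorem IsEquilibriumWith.mul_nonneg (hx : IsEquilibriumWith j q l x)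
    (hy : IsEquilibriumWith j r m y) : 0 ≤ (q - r) * (l - m) :=
  (Finset.sum_nonneg fun e _ => _root_.mul_nonneg (slope_nonneg e) (sq_nonneg _)).trans
    (hx.sum_le hy)

/-- Strictness of `q < r` matters: at `q = r = 0` the length is not determined. -/
theorem IsEquilibriumWith.length_le (hx : IsEquilibriumWith j q l x)
    (hy : IsEquilibriumWith j r m y) (h : q < r) : l ≤ m := by
  have := hx.mul_nonneg hy
  nlinarith

theorem IsEquilibriumWith.flow_unique (hx : IsEquilibriumWith j q l x)
    (hy : IsEquilibriumWith j q m y) : x = y := by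
  have h := hx.sum_le hy
  rw [sub_self, zero_mul] at h
  have hn : ∀ e ∈ (nestedBraess j).edges, 0 ≤ slope j e * (x e - y e) ^ 2 :=
    fun e _ => _root_.mul_nonneg (slope_nonneg e) (sq_nonneg _)
  have h0 := (Finset.sum_eq_zero_iff_of_nonneg hn).1 (le_antisymm h (Finset.sum_nonneg hn))
  have hz : ∀ e, e ∉ (nestedBraess j).edges → x e - y e = 0 := fun e he => by
    rw [hx.feasible.eq_zero e he, hy.feasible.eq_zero e he, sub_self]
  have := circulation_eq_zero (d := fun e => x e - y e) hz (fun e he => ?_) fun v => ?_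
  · funext e
    exact sub_eq_zero.1 (this e)
  · by_cases hm : e ∈ (nestedBraess j).edges
    · have := h0 e hm
      simpa [he] using this
    · exact hz e hm
  · have h1 := hx.feasible.balance v
    have h2 := hy.feasible.balance v
    simp only [Finset.sum_sub_distrib]
    linarith

theorem isWardropEquilibrium_unique (hx : (nestedBraess j).IsWardropEquilibrium q x)
    (hy : (nestedBraess j).IsWardropEquilibrium q y) : x = y := by
  obtain ⟨l, hl⟩ := exists_isEquilibriumWith hx
  obtain ⟨m, hm⟩ := exists_isEquilibriumWith hy
  exact hl.flow_unique hm

/-- Without flow no edge need be tight, so the target's potential may be lowered freely. Negative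
`l` describes an idle inner network inside a larger one. -/
theorem isEquilibriumWith_zero_flow (j : ℕ) (hl : l ≤ 0) : IsEquilibriumWith j 0 l 0 := by
  refine ⟨IsFeasible.of_balance (by simp) (by simp) fun v => by simp only [Pi.zero_apply,
      Finset.sum_const_zero, ite_self, sub_self],
    fun v => if v = Fin.last (2 * j + 1) then l else 0, ⟨fun e he => ?_, by simp⟩, by simp⟩
  have h1 : e.1 ≠ Fin.last (2 * j + 1) := by
    rintro h
    exact last_mk_not_mem_edges (u := e.2) (by rwa [← h])
  have h2 : 0 ≤ offset j e := by
    unfold offset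
    split_ifs <;> positivity
  rw [cost_def, if_neg h1]
  split_ifs <;> simp <;> linarith

/-- The flow in the next network that sends `y` units along `x`, entering and leaving on the
edges with linear cost, and `z` units along each of the two paths around the inner network. -/
def surround (y z : ℝ) (x : Vertex j × Vertex j → ℝ) (e : Vertex (j + 1) × Vertex (j + 1)) : ℝ :=
  frame (frame 0 (fun v => if v = 0 then y + z else if v = Fin.last (2 * j + 1) then z else 0) 0)
    (fun u => frame 0 (fun v => x (u, v))
      (if u = 0 then z else if u = Fin.last (2 * j + 1) then y + z else 0)) (fun _ => 0) e.1 e.2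

/-- The path through the inner network has length `2 (q + z) + l`, a bypass path `q + z + 10 ^ j`.
The hypotheses say that the former is no longer, and that both agree when the bypasses are used. -/
theorem IsEquilibriumWith.surround {z : ℝ} (hx : IsEquilibriumWith j q l x) (hq : 0 ≤ q)
    (hz : 0 ≤ z) (hle : q + z + l ≤ 10 ^ j) (heq : 0 < z → q + z + l = 10 ^ j) :
    IsEquilibriumWith (j + 1) (q + 2 * z) (2 * (q + z) + l) (surround q z x) := by
  obtain ⟨hx, π, hπ, hl⟩ := hx
  refine ⟨IsFeasible.of_balance ?_ ?_ ?_,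
    frame 0 (fun v => q + z + (π v - π 0)) (2 * (q + z) + l), ⟨?_, ?_⟩, by simp⟩
  · simp only [Prod.forall, forall_vertex_succ (j := j), shift_shift_mem_edges,
      zero_shift_mem_edges, shift_last_mem_edges, NestedBraess.surround]
    refine ⟨⟨by simp, fun v hv => ?_, by simp⟩, fun u => ⟨by simp, fun v hv => ?_, fun hv => ?_⟩,
      by simp, by simp, by simp⟩
    · rw [not_or] at hv
      simp [hv]
    · simpa using hx.eq_zero _ hv
    · rw [not_or] at hv
      simp [hv]
  · simp only [Prod.forall, forall_vertex_succ (j := j), NestedBraess.surround]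
    refine ⟨⟨by simp, fun v => ?_, by simp⟩, fun u => ⟨by simp, fun v => ?_, ?_⟩,
      by simp, by simp, by simp⟩
    · simp only [frame_zero, frame_shift]
      split_ifs <;> linarith
    · simpa using hx.nonneg' _
    · simp only [frame_last, frame_shift]
      split_ifs <;> linarith
  · have hb := hx.balance
    simp only [source_nestedBraess, target_nestedBraess] at hb
    simp only [forall_vertex_succ (j := j), NestedBraess.surround, sum_vertex_succ, frame_zero,
      frame_shift, frame_last, Finset.sum_const_zero, sum_ite_zero_or_last, source_nestedBraess,
      target_nestedBraess, shift_ne_zero, shift_ne_last, zero_ne_last, last_ne_zero, if_true,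
      if_false]
    refine ⟨by ring, fun v => ?_, by ring⟩
    have hv := hb v
    by_cases hv0 : v = 0
    · subst hv0
      simp only [if_true, zero_ne_last, if_false] at hv ⊢
      linarith
    · by_cases hvl : v = Fin.last (2 * j + 1)
      · subst hvl
        simp only [if_true, hv0, if_false] at hv ⊢
        linarith
      · simp only [hv0, hvl, if_false] at hv ⊢
        linarith
  · rw [forall_edges_succ]
    simp only [cost_zero_shift_zero, cost_zero_shift_last, cost_shift_zero_last,
      cost_shift_last_last, cost_shift_shift, NestedBraess.surround, frame_zero, frame_shift,
      frame_last, if_true, last_ne_zero, if_false, hl]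
    refine ⟨by linarith, by linarith, by linarith, by linarith, fun e he => ?_⟩
    have := hπ.le e he
    simp only [Prod.mk.eta]
    linarith
  · rw [forall_edges_succ]
    simp only [cost_zero_shift_zero, cost_zero_shift_last, cost_shift_zero_last,
      cost_shift_last_last, cost_shift_shift, NestedBraess.surround, frame_zero, frame_shift,
      frame_last, if_true, last_ne_zero, if_false, hl]
    refine ⟨fun _ => by linarith, fun h => by linarith [heq h], fun h => by linarith [heq h],
      fun _ => by linarith, fun e he h => ?_⟩
    have := hπ.tight e he h
    simp only [Prod.mk.eta] at this ⊢
    linarith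

end NestedBraess

/-! ### Existence of equilibria -/

namespace NestedBraess

open DirectedNetwork

theorem isEquilibriumWith_single_edge {q : ℝ} (hq : 0 ≤ q) :
    IsEquilibriumWith 0 q 0 (fun e => if e = (0, 1) then q else 0) := by
  refine ⟨IsFeasible.of_balance (fun e he => ?_) (fun e => ?_) (fun v => ?_), 0,
    ⟨fun e he => ?_, fun e he _ => ?_⟩, by simp⟩
  · rw [edges_zero, Finset.mem_singleton] at he
    exact if_neg he
  · split_ifs
    exacts [hq, le_rfl]
  · rw [source_nestedBraess, target_nestedBraess]
    fin_cases v <;> simp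
  · simp [cost_zero e _ he]
  · simp [cost_zero e _ he]

/-- Continuity of the length is carried through the induction so that the equation determining the
inner demand can be solved. -/
theorem exists_continuous_length (j : ℕ) : ∃ ℓ : ℝ → ℝ, Continuous ℓ ∧ ℓ 0 = 0 ∧
    ∀ q, 0 ≤ q → ∃ x, IsEquilibriumWith j q (ℓ q) x := by
  induction j with
  | zero => exact ⟨fun _ => 0, continuous_const, rfl, fun q hq =>
      ⟨_, isEquilibriumWith_single_edge hq⟩⟩
  | succ j ih =>
    obtain ⟨ℓ, hc, h0, hℓ⟩ := ih
    have hmono : ∀ a b, 0 ≤ a → a ≤ b → ℓ a ≤ ℓ b := by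
      intro a b ha hab
      rcases hab.eq_or_lt with rfl | hlt
      · exact le_rfl
      obtain ⟨x, hx⟩ := hℓ a ha
      obtain ⟨y, hy⟩ := hℓ b (ha.trans hab)
      exact hx.length_le hy hlt
    set C : ℝ := 10 ^ j with hC
    have hCpos : 0 < C := by positivity
    -- With `z = (q - y) / 2`, the condition `y + z + ℓ y = C` reads `g y = 2 * C - q`. Clamping the
    -- argument of `ℓ` extends `g` by the identity to negative `y`, making it a bijection of the
    -- line.
    let g : ℝ → ℝ := fun y => 2 * ℓ (max y 0) + y
    have hg0 : g 0 = 0 := by simp [g, h0]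
    have hgpos : ∀ y, 0 ≤ y → g y = 2 * ℓ y + y := fun y hy => by simp [g, hy]
    have hgc : Continuous g := by fun_prop
    have hgm : StrictMono g := by
      intro a b hab
      have := hmono (max a 0) (max b 0) (le_max_right _ _) (max_le_max_right 0 hab.le)
      simp only [g]
      linarith
    have htop : Filter.Tendsto g Filter.atTop Filter.atTop := by
      refine Filter.tendsto_atTop_mono (fun y => ?_) Filter.tendsto_id
      have := hmono 0 (max y 0) le_rfl (le_max_right _ _)
      simp only [g, id]
      linarith
    have hbot : Filter.Tendsto g Filter.atBot Filter.atBot := by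
      refine Filter.Tendsto.congr' ?_ Filter.tendsto_id
      filter_upwards [Filter.eventually_le_atBot 0] with y hy
      simp [g, hy, h0]
    let e := hgm.orderIsoOfSurjective g (hgc.surjective htop hbot)
    have he : ∀ t, g (e.symm t) = t := fun t => e.apply_symm_apply t
    have he' : ∀ y, e.symm (g y) = y := fun y => e.symm_apply_apply y
    have hec : Continuous e.symm := e.symm.continuous
    have he0 : e.symm 0 = 0 := by simpa [hg0] using he' 0
    have hψ : ∀ t, 0 ≤ e.symm (max 0 t) := fun t => by
      have := e.symm.monotone (le_max_left 0 t)
      rwa [he0] at this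
    -- The inner demand: the first argument of `min` is the phase without bypass flow; the inner
    -- `max` makes the demand 0 once `q ≥ 2 * C`.
    let Y : ℝ → ℝ := fun q => min q (e.symm (max 0 (2 * C - q)))
    have hYc : Continuous Y := by fun_prop
    -- The `min` is the inner length: it is `ℓ (Y q)` until the inner network becomes idle, then the
    -- negative value `C - q / 2`.
    refine ⟨fun q => (q + Y q) + min (C - (q + Y q) / 2) (ℓ (Y q)), by fun_prop, ?_,
      fun q hq => ?_⟩
    · have : Y 0 = 0 := min_eq_left (hψ _)
      simp [this, h0, hCpos.le]
    rcases le_or_gt q (e.symm (max 0 (2 * C - q))) with hle | hlt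
    · have hY : Y q = q := min_eq_left hle
      have hqℓ : q + ℓ q ≤ C := by
        have h1 := hgm.monotone hle
        rw [he, hgpos q hq] at h1
        rcases hq.eq_or_lt with rfl | hpos
        · simp [h0, hCpos.le]
        · have h2 := hmono 0 q le_rfl hq
          rcases le_max_iff.1 h1 with h | h <;> linarith
      obtain ⟨x, hx⟩ := hℓ q hq
      have := hx.surround (z := 0) hq le_rfl (by linarith) (fun h => absurd h (lt_irrefl 0))
      refine ⟨surround q 0 x, ?_⟩
      convert this using 1
      · ring
      · simp only [hY]
        rw [min_eq_right (by linarith)]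
        ring
    · have hY : Y q = e.symm (max 0 (2 * C - q)) := min_eq_right hlt.le
      have hψ := hψ (2 * C - q)
      rw [← hY] at hlt hψ
      have hgY : g (Y q) = max 0 (2 * C - q) := by rw [hY, he]
      rw [hgpos _ hψ] at hgY
      obtain ⟨l, x, hl, hx, hlC⟩ : ∃ l x, l = min (C - (q + Y q) / 2) (ℓ (Y q)) ∧
          IsEquilibriumWith j (Y q) l x ∧ Y q + (q - Y q) / 2 + l = C := by
        rcases le_or_gt 0 (2 * C - q) with h | h
        · rw [max_eq_right h] at hgY
          obtain ⟨x, hx⟩ := hℓ (Y q) hψ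
          refine ⟨_, x, ?_, hx, by linarith⟩
          rw [min_eq_right (by linarith)]
        · have hY0 : Y q = 0 := by
            rw [hY, max_eq_left h.le, he0]
          refine ⟨C - q / 2, 0, ?_, ?_, ?_⟩
          · rw [hY0, h0, min_eq_left (by linarith), add_zero]
          · rw [hY0]
            exact isEquilibriumWith_zero_flow j (by linarith)
          · rw [hY0]
            ring
      have := hx.surround (z := (q - Y q) / 2) hψ (by linarith) hlC.le (fun _ => hlC)
      refine ⟨surround (Y q) ((q - Y q) / 2) x, ?_⟩
      convert this using 1
      · ring
      · simp only [← hl]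
        ring

theorem existsUnique_isWardropEquilibrium (j : ℕ) {q : ℝ} (hq : 0 ≤ q) :
    ∃! x, (nestedBraess j).IsWardropEquilibrium q x := by
  obtain ⟨ℓ, -, -, hℓ⟩ := exists_continuous_length j
  obtain ⟨x, hx⟩ := hℓ q hq
  exact ⟨x, hx.isWardropEquilibrium, fun y hy =>
    isWardropEquilibrium_unique hy hx.isWardropEquilibrium⟩

/-! ### Doubling of the supports -/

section Supports

variable {j : ℕ}

/-- The support in the next network, for the support `S` in the inner network, where `p` says
whether the two paths around the inner network are used. -/
def surroundSupport (p : Prop) (S : Set (Vertex j × Vertex j)) :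
    Set (Vertex (j + 1) × Vertex (j + 1)) :=
  {e | (∃ e' ∈ S, (shift e'.1, shift e'.2) = e) ∨ e = (0, shift 0) ∨
    e = (shift (Fin.last (2 * j + 1)), Fin.last (2 * (j + 1) + 1)) ∨
    p ∧ (e = (0, shift (Fin.last (2 * j + 1))) ∨ e = (shift 0, Fin.last (2 * (j + 1) + 1)))}

theorem shift_mem_surroundSupport {p : Prop} {S : Set (Vertex j × Vertex j)}
    (e : Vertex j × Vertex j) : (shift e.1, shift e.2) ∈ surroundSupport p S ↔ e ∈ S := by
  simp [surroundSupport]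

theorem zero_shift_last_mem_surroundSupport {p : Prop} {S : Set (Vertex j × Vertex j)} :
    (0, shift (Fin.last (2 * j + 1))) ∈ surroundSupport p S ↔ p := by
  simp [surroundSupport]

theorem surroundSupport_inj {p r : Prop} {S T : Set (Vertex j × Vertex j)} :
    surroundSupport p S = surroundSupport r T ↔ (p ↔ r) ∧ S = T := by
  refine ⟨fun h => ⟨?_, ?_⟩, fun ⟨h1, h2⟩ => by rw [h2, propext h1]⟩
  · have := Set.ext_iff.1 h (0, shift (Fin.last (2 * j + 1)))
    rwa [zero_shift_last_mem_surroundSupport, zero_shift_last_mem_surroundSupport] at this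
  · ext e
    rw [← shift_mem_surroundSupport (p := p), h, shift_mem_surroundSupport]

theorem flowSupport_surround {q z : ℝ} {x : Vertex j × Vertex j → ℝ}
    (hpos : 0 < q + z) : (nestedBraess (j + 1)).flowSupport (surround q z x) =
      surroundSupport (0 < z) ((nestedBraess j).flowSupport x) := by
  have key : ∀ e, e ∈ (nestedBraess (j + 1)).flowSupport (surround q z x) ↔
      e ∈ surroundSupport (0 < z) ((nestedBraess j).flowSupport x) := by
    simp only [Prod.forall, forall_vertex_succ (j := j)]
    refine ⟨⟨?_, fun v => ?_, ?_⟩, fun u => ⟨?_, fun v => ?_, ?_⟩, ?_, fun v => ?_, ?_⟩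
    · simp [flowSupport, surroundSupport]
    · by_cases h0 : v = 0
      · subst h0
        simp [flowSupport, surroundSupport, surround, hpos]
      · by_cases hl : v = Fin.last (2 * j + 1)
        · subst hl
          simp [flowSupport, surroundSupport, surround]
        · simp [flowSupport, surroundSupport, h0, hl]
    · simp [flowSupport, surroundSupport]
    · simp [flowSupport, surroundSupport]
    · simp [flowSupport, surroundSupport, surround]
    · by_cases h0 : u = 0
      · subst h0
        simp [flowSupport, surroundSupport, surround]
      · by_cases hl : u = Fin.last (2 * j + 1)
        · subst hl
          simp [flowSupport, surroundSupport, surround, hpos]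
        · simp [flowSupport, surroundSupport, h0, hl]
    · simp [flowSupport, surroundSupport]
    · simp [flowSupport, surroundSupport]
    · simp [flowSupport, surroundSupport]
  exact Set.ext key

/-- The demand rates in `(0, 3 * 10 ^ (j - 1))` whose equilibrium has the support `S`. -/
def supportRates (j : ℕ) (S : Set (Vertex j × Vertex j)) : Set ℝ :=
  {q | 0 < q ∧ q < 3 * 10 ^ j / 10 ∧
    ∃ l x, IsEquilibriumWith j q l x ∧ (nestedBraess j).flowSupport x = S}

/-- The nonempty support sets that occur for infinitely many demand rates. -/
def recurrentSupports (j : ℕ) : Set (Set (Vertex j × Vertex j)) :=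
  {S | S.Nonempty ∧ (supportRates j S).Infinite}

/-- By monotonicity the right end of the range suffices. There, for positive `j`, the next smaller
network is idle and the length is explicit. This is where the growth factor 10 leaves room: every
inner rate in the range occurs both with and without bypass flow. -/
theorem IsEquilibriumWith.add_length_lt {q l : ℝ} {x : Vertex j × Vertex j → ℝ}
    (hx : IsEquilibriumWith j q l x) (hq : q < 3 * 10 ^ j / 10) : q + l < 10 ^ j := by
  suffices h : ∃ m y, IsEquilibriumWith j (3 * 10 ^ j / 10) m y ∧
      3 * 10 ^ j / 10 + m < (10 : ℝ) ^ j by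
    obtain ⟨m, y, hy, hm⟩ := h
    have := hx.length_le hy hq
    linarith
  cases j with
  | zero => exact ⟨0, _, isEquilibriumWith_single_edge (by norm_num), by norm_num⟩
  | succ j =>
    have hC : (0 : ℝ) < 10 ^ j := by positivity
    -- Total demand `3 * 10 ^ j`, length `5 / 2 * 10 ^ j`, and their sum `11 / 2 * 10 ^ j` is below
    -- `10 ^ (j + 1)`.
    have := (isEquilibriumWith_zero_flow j (l := 10 ^ j - 3 * 10 ^ j / 2) (by linarith)).surround
      (z := 3 * 10 ^ j / 2) le_rfl (by linarith) (by linarith) (fun _ => by ring)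
    refine ⟨5 / 2 * 10 ^ j, NestedBraess.surround 0 (3 * 10 ^ j / 2) 0, ?_, ?_⟩
    · convert this using 1 <;> ring
    · rw [pow_succ]
      linarith

theorem surroundSupport_false_mem {S : Set (Vertex j × Vertex j)} (hS : S ∈ recurrentSupports j) :
    surroundSupport False S ∈ recurrentSupports (j + 1) := by
  refine ⟨⟨(0, shift 0), by simp [surroundSupport]⟩, hS.2.mono ?_⟩
  rintro q ⟨h0, hq, l, x, hx, rfl⟩
  have hC : (0 : ℝ) < 10 ^ j := by positivity
  have hs := hx.surround (z := 0) h0.le le_rfl (by linarith [hx.add_length_lt hq])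
    (fun h => absurd h (lt_irrefl 0))
  rw [mul_zero, add_zero] at hs
  refine ⟨h0, ?_, _, _, hs, ?_⟩
  · rw [pow_succ]
    linarith
  · rw [flowSupport_surround (by linarith), surroundSupport_inj]
    simp

/-- The backward phase: with `z = 10 ^ j - q - ℓ q` the total demand strictly decreases in the inner
demand `q`, so infinitely many rates remain infinitely many. -/
theorem surroundSupport_true_mem {S : Set (Vertex j × Vertex j)} (hS : S ∈ recurrentSupports j) :
    surroundSupport True S ∈ recurrentSupports (j + 1) := by
  refine ⟨⟨(0, shift 0), by simp [surroundSupport]⟩, ?_⟩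
  have hC : (0 : ℝ) < 10 ^ j := by positivity
  have h : ∀ q, ∃ l, q ∈ supportRates j S →
      ∃ x, IsEquilibriumWith j q l x ∧ (nestedBraess j).flowSupport x = S := by
    intro q
    by_cases hq : q ∈ supportRates j S
    · obtain ⟨-, -, l, hl⟩ := hq
      exact ⟨l, fun _ => hl⟩
    · exact ⟨0, fun h => absurd h hq⟩
  choose ℓ hℓ using h
  have hinj : Set.InjOn (fun q => q + 2 * (10 ^ j - q - ℓ q)) (supportRates j S) := by
    refine StrictAntiOn.injOn fun a ha b hb hab => ?_
    obtain ⟨x, hx, -⟩ := hℓ a ha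
    obtain ⟨y, hy, -⟩ := hℓ b hb
    have := hx.length_le hy hab
    linarith
  refine (hS.2.image hinj).mono ?_
  rintro _ ⟨q, hq, rfl⟩
  obtain ⟨x, hx, hxS⟩ := hℓ q hq
  have h1 := hx.add_length_lt hq.2.1
  -- Comparison with the zero flow at length 0 gives `0 ≤ ℓ q`, which bounds the total demand by `2
  -- * 10 ^ j`.
  have h2 := (isEquilibriumWith_zero_flow j (le_refl (0 : ℝ))).length_le hx hq.1
  have h0 := hq.1
  refine ⟨by simp only; linarith, by simp only [pow_succ]; linarith, _, _,
    hx.surround h0.le (by linarith) (by linarith) (fun _ => by ring), ?_⟩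
  rw [flowSupport_surround (by linarith), surroundSupport_inj]
  exact ⟨by simp; linarith, hxS⟩

theorem surroundSupport_true_empty_mem (j : ℕ) :
    surroundSupport True ∅ ∈ recurrentSupports (j + 1) := by
  have hC : (0 : ℝ) < 10 ^ j := by positivity
  refine ⟨⟨(0, shift 0), by simp [surroundSupport]⟩,
    (Set.Ioo_infinite (a := 2 * (10 : ℝ) ^ j) (b := 3 * 10 ^ j) (by linarith)).mono ?_⟩
  rintro q ⟨h2, h3⟩
  have hs := (isEquilibriumWith_zero_flow j (l := 10 ^ j - q / 2) (by linarith)).surround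
    (z := q / 2) le_rfl (by linarith) (by linarith) (fun _ => by ring)
  rw [show 0 + 2 * (q / 2) = q by ring] at hs
  refine ⟨by linarith, by simp only [pow_succ]; linarith, _, _, hs, ?_⟩
  rw [flowSupport_surround (by linarith), surroundSupport_inj]
  exact ⟨by simp; linarith, by simp [flowSupport]⟩

/-- Each inner support yields two, without and with bypass flow; the idle inner network yields one
more. -/
theorem two_pow_le_ncard_recurrentSupports (j : ℕ) :
    2 ^ (j + 1) ≤ (recurrentSupports j).ncard + 1 := by
  induction j with
  | zero =>
    have : {(0, 1)} ∈ recurrentSupports 0 := by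
      refine ⟨Set.singleton_nonempty _,
        (Set.Ioo_infinite (a := (0 : ℝ)) (b := 3 * 10 ^ 0 / 10) (by norm_num)).mono ?_⟩
      rintro q ⟨h0, h1⟩
      refine ⟨h0, h1, _, _, isEquilibriumWith_single_edge h0.le, ?_⟩
      ext e
      simp only [flowSupport, edges_zero, Finset.mem_singleton, Set.mem_ofPred_eq,
        Set.mem_singleton_iff]
      refine ⟨fun h => h.1, fun h => ⟨h, by rwa [if_pos h]⟩⟩
    have := (Set.ncard_pos (Set.toFinite _)).2 ⟨_, this⟩
    omega
  | succ j ih =>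
    have hinj : ∀ p, Function.Injective (surroundSupport (j := j) p) :=
      fun p S T h => (surroundSupport_inj.1 h).2
    have hsub : surroundSupport False '' recurrentSupports j ∪
        surroundSupport True '' insert ∅ (recurrentSupports j) ⊆ recurrentSupports (j + 1) := by
      rintro _ (⟨S, hS, rfl⟩ | ⟨S, rfl | hS, rfl⟩)
      exacts [surroundSupport_false_mem hS, surroundSupport_true_empty_mem j,
        surroundSupport_true_mem hS]
    have hdisj : Disjoint (surroundSupport False '' recurrentSupports j)
        (surroundSupport True '' insert ∅ (recurrentSupports j)) := by
      rw [Set.disjoint_left]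
      rintro _ ⟨S, -, rfl⟩ ⟨T, -, h⟩
      simpa using (surroundSupport_inj.1 h).1
    have hne : ∅ ∉ recurrentSupports j := fun h => Set.not_nonempty_empty h.1
    have := Set.ncard_le_ncard hsub (Set.toFinite _)
    rw [Set.ncard_union_eq hdisj (Set.toFinite _) (Set.toFinite _),
      Set.ncard_image_of_injective _ (hinj _), Set.ncard_image_of_injective _ (hinj _),
      Set.ncard_insert_of_notMem hne (Set.toFinite _)] at this
    rw [pow_succ]
    omega

end Supports

end NestedBraess

/-! ### Lower bound on the number of breakpoints -/

namespace NestedBraess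

open DirectedNetwork Filter Topology

variable {j : ℕ}

/-- An affine function with an interior zero changes sign there unless its slope is 0. -/
theorem eq_zero_of_affine_of_nonneg {h : ℝ → ℝ} {a b M N p r : ℝ}
    (hh : ∀ q ∈ Set.Icc a b, h q = q * M + N) (hn : ∀ q ∈ Set.Icc a b, 0 ≤ h q)
    (hp : p ∈ Set.Ioo a b) (hr : r ∈ Set.Ioo a b) (h0 : h p = 0) : h r = 0 := by
  have hab : a ≤ b := (hp.1.trans hp.2).le
  have h1 := hn a ⟨le_rfl, hab⟩
  have h2 := hn b ⟨hab, le_rfl⟩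
  rw [hh _ ⟨le_rfl, hab⟩] at h1
  rw [hh _ ⟨hab, le_rfl⟩] at h2
  rw [hh _ (Set.Ioo_subset_Icc_self hp)] at h0
  rw [hh _ (Set.Ioo_subset_Icc_self hr)]
  have hM : M = 0 := by
    refine le_antisymm ?_ ?_
    · by_contra hM
      nlinarith [hp.1, not_le.1 hM]
    · by_contra hM
      nlinarith [hp.2, not_le.1 hM]
  subst hM
  linarith

theorem flowSupport_eq_of_affine {f : ℝ → Vertex j × Vertex j → ℝ}
    (hf : (nestedBraess j).IsEquilibriumFunction f) {a b p r : ℝ} (ha : 0 ≤ a)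
    (h : ∃ M N : Vertex j × Vertex j → ℝ, ∀ q ∈ Set.Icc a b, f q = q • M + N)
    (hp : p ∈ Set.Ioo a b) (hr : r ∈ Set.Ioo a b) :
    (nestedBraess j).flowSupport (f p) = (nestedBraess j).flowSupport (f r) := by
  obtain ⟨M, N, h⟩ := h
  have hn : ∀ e, ∀ q ∈ Set.Icc a b, 0 ≤ f q e :=
    fun e q hq => (hf q (ha.trans hq.1)).feasible.nonneg' e
  have hh : ∀ e, ∀ q ∈ Set.Icc a b, f q e = q * M e + N e := fun e q hq => by simp [h q hq]
  ext e
  simp only [flowSupport, Set.mem_ofPred_eq, and_congr_right_iff]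
  intro _
  rw [(hn e p (Set.Ioo_subset_Icc_self hp)).lt_iff_ne,
    (hn e r (Set.Ioo_subset_Icc_self hr)).lt_iff_ne]
  refine not_congr ⟨fun h0 => ?_, fun h0 => ?_⟩
  · exact (eq_zero_of_affine_of_nonneg (hh e) (hn e) hp hr h0.symm).symm
  · exact (eq_zero_of_affine_of_nonneg (hh e) (hn e) hr hp h0.symm).symm

theorem flowSupport_of_mem_supportRates {f : ℝ → Vertex j × Vertex j → ℝ}
    (hf : (nestedBraess j).IsEquilibriumFunction f) {S : Set (Vertex j × Vertex j)} {q : ℝ}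
    (hq : q ∈ supportRates j S) : (nestedBraess j).flowSupport (f q) = S := by
  obtain ⟨h0, -, l, x, hx, rfl⟩ := hq
  rw [isWardropEquilibrium_unique (hf q h0.le) hx.isWardropEquilibrium]

theorem exists_gt_forall_notMem_Ioo (B : Finset ℝ) (q : ℝ) :
    ∃ c, q < c ∧ ∀ b ∈ B, b ∉ Set.Ioo q c := by
  rcases (B.filter (q < ·)).eq_empty_or_nonempty with h | h
  · refine ⟨q + 1, by linarith, fun b hb hbc => ?_⟩
    have : b ∈ B.filter (q < ·) := Finset.mem_filter.2 ⟨hb, hbc.1⟩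
    simp [h] at this
  · refine ⟨(B.filter (q < ·)).min' h, (Finset.mem_filter.1 (Finset.min'_mem _ h)).2,
      fun b hb hbc => ?_⟩
    exact (Finset.min'_le _ b (Finset.mem_filter.2 ⟨hb, hbc.1⟩)).not_gt hbc.2

/-- Infinitely many rates have support `S`, so one avoids the finite set `B`. Mapping `S` to the
last breakpoint below that rate is injective. -/
theorem ncard_recurrentSupports_le_card {f : ℝ → Vertex j × Vertex j → ℝ}
    (hf : (nestedBraess j).IsEquilibriumFunction f) {B : Finset ℝ} (hB : IsBreakpointSet f B) :
    (recurrentSupports j).ncard ≤ B.card := by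
  have h : ∀ S ∈ recurrentSupports j, ∃ q ∈ supportRates j S, q ∉ B ∧
      ∃ b ∈ B, b < q ∧ ∀ b' ∈ B, b' < q → b' ≤ b := by
    intro S hS
    obtain ⟨q, hq, hqB⟩ := (hS.2.sdiff B.finite_toSet).nonempty
    obtain ⟨b, hb, hmax⟩ := Finset.exists_max_image (B.filter (· < q)) id
      ⟨0, Finset.mem_filter.2 ⟨hB.zero_mem, hq.1⟩⟩
    rw [Finset.mem_filter] at hb
    exact ⟨q, hq, hqB, b, hb.1, hb.2, fun b' h1 h2 => hmax b' (Finset.mem_filter.2 ⟨h1, h2⟩)⟩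
  choose! q hq hqB β hβB hβ hmax using h
  rw [← Set.ncard_coe_finset]
  have key : ∀ S ∈ recurrentSupports j, ∀ T ∈ recurrentSupports j, β S = β T → q S ≤ q T →
      S = T := by
    intro S hS T hT hST hle
    -- Both rates lie in the breakpoint-free interval from the common `β` to `c`, where the support
    -- is constant.
    obtain ⟨c, hc, hcB⟩ := exists_gt_forall_notMem_Ioo B (q T)
    have hno : ∀ t ∈ B, t ∉ Set.Ioo (β T) c := by
      intro t ht htc
      rcases lt_trichotomy t (q T) with h | h | h
      · exact (hmax T hT t ht h).not_gt htc.1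
      · exact hqB T hT (h ▸ ht)
      · exact hcB t ht ⟨h, htc.2⟩
    have hb := hβ T hT
    rw [← flowSupport_of_mem_supportRates hf (hq S hS),
      ← flowSupport_of_mem_supportRates hf (hq T hT)]
    exact flowSupport_eq_of_affine hf (hB.nonneg _ (hβB T hT))
      (hB.affine (β T) c (hB.nonneg _ (hβB T hT)) (hb.trans hc).le hno)
      ⟨hST ▸ hβ S hS, hle.trans_lt hc⟩ ⟨hb, hc⟩
  refine Set.ncard_le_ncard_of_injOn β (fun S hS => hβB S hS) (fun S hS T hT hST => ?_)
    B.finite_toSet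
  rcases le_total (q S) (q T) with h | h
  · exact key S hS T hT hST h
  · exact (key T hT S hS hST.symm h).symm

/-! ### Existence of a piecewise linear representation -/

section PiecewiseLinear

theorem pathCost_combination {x y : Vertex j × Vertex j → ℝ} {α β : ℝ} (h : α + β = 1)
    (p : List (Vertex j)) : (nestedBraess j).pathCost (α • x + β • y) p =
      α * (nestedBraess j).pathCost x p + β * (nestedBraess j).pathCost y p := by
  simp only [pathCost, ← List.sum_map_mul_left, ← List.sum_map_add, cost_def, Pi.add_apply,
    Pi.smul_apply, smul_eq_mul]
  congr 2
  funext e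
  linear_combination (-offset j e) * h

theorem isFeasible_combination {x y : Vertex j × Vertex j → ℝ} {α β q r : ℝ} (hα : 0 ≤ α)
    (hβ : 0 ≤ β) (hx : (nestedBraess j).IsFeasible q x) (hy : (nestedBraess j).IsFeasible r y) :
    (nestedBraess j).IsFeasible (α * q + β * r) (α • x + β • y) := by
  refine IsFeasible.of_balance (fun e he => ?_) (fun e => ?_) fun v => ?_
  · simp [hx.eq_zero e he, hy.eq_zero e he]
  · have := mul_nonneg hα (hx.nonneg' e)
    have := mul_nonneg hβ (hy.nonneg' e)
    simp only [Pi.add_apply, Pi.smul_apply, smul_eq_mul]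
    linarith
  · have h1 := hx.balance v
    have h2 := hy.balance v
    simp only [Pi.add_apply, Pi.smul_apply, smul_eq_mul, Finset.sum_add_distrib,
      ← Finset.mul_sum]
    have : ∀ p : Prop, [Decidable p] → (if p then α * q + β * r else 0) =
        α * (if p then q else 0) + β * (if p then r else 0) := by
      intro p _
      split_ifs <;> ring
    rw [this, this]
    linear_combination α * h1 + β * h2

theorem flowSupport_combination {x y : Vertex j × Vertex j → ℝ} {α β : ℝ} (hα : 0 < α)
    (hβ : 0 ≤ β)
    (h : (nestedBraess j).flowSupport y = (nestedBraess j).flowSupport x)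
    {q r : ℝ} (hx : (nestedBraess j).IsFeasible q x) (hy : (nestedBraess j).IsFeasible r y)
    (e : Vertex j × Vertex j) : 0 < (α • x + β • y) e ↔ 0 < x e := by
  have hxe := hx.nonneg' e
  have hye := hy.nonneg' e
  have hs := Set.ext_iff.1 h e
  simp only [flowSupport, Set.mem_ofPred_eq] at hs
  simp only [Pi.add_apply, Pi.smul_apply, smul_eq_mul]
  refine ⟨fun hpos => ?_, fun hpos => by positivity⟩
  by_contra hx0
  have hx0' : x e = 0 := le_antisymm (not_lt.1 hx0) hxe
  have hy0 : ¬ 0 < y e := fun hy0 => hx0 (hs.1 ⟨hy.mem_edges hy0, hy0⟩).2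
  have hy0' : y e = 0 := le_antisymm (not_lt.1 hy0) hye
  simp [hx0', hy0'] at hpos

/-- Equal supports mean equal flow-carrying paths, and path lengths are affine in the flow, so the
inequalities can be averaged. -/
theorem isWardropEquilibrium_combination {x y : Vertex j × Vertex j → ℝ} {α β q r : ℝ}
    (hα : 0 < α) (hβ : 0 < β) (hαβ : α + β = 1)
    (h : (nestedBraess j).flowSupport y = (nestedBraess j).flowSupport x)
    (hx : (nestedBraess j).IsWardropEquilibrium q x)
    (hy : (nestedBraess j).IsWardropEquilibrium r y) :
    (nestedBraess j).IsWardropEquilibrium (α * q + β * r) (α • x + β • y) where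
  feasible := isFeasible_combination hα.le hβ.le hx.feasible hy.feasible
  no_cycle c hc := (not_isCycle fst_lt_snd c hc).elim
  path_le P Q hP hQ hc := by
    have h1 : FlowCarrying x P := fun e he =>
      (flowSupport_combination hα hβ.le h hx.feasible hy.feasible e).1 (hc e he)
    have h2 : FlowCarrying y P := fun e he => by
      have := hc e he
      rw [add_comm] at this
      exact (flowSupport_combination hβ hα.le h.symm hy.feasible hx.feasible e).1 this
    rw [pathCost_combination hαβ, pathCost_combination hαβ]
    exact add_le_add (mul_le_mul_of_nonneg_left (hx.path_le P Q hP hQ h1) hα.le)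
      (mul_le_mul_of_nonneg_left (hy.path_le P Q hP hQ h2) hβ.le)

theorem continuous_pathCost (p : List (Vertex j)) :
    Continuous fun x => (nestedBraess j).pathCost x p := by
  refine continuous_list_sum _ fun e _ => ?_
  simp only [cost_def]
  fun_prop

theorem isWardropEquilibrium_of_tendsto {ι : Type*} {F : Filter ι} [F.NeBot] {u : ι → ℝ}
    {g : ι → Vertex j × Vertex j → ℝ} {q : ℝ} {x : Vertex j × Vertex j → ℝ}
    (hu : Tendsto u F (𝓝 q)) (hg : Tendsto g F (𝓝 x))
    (h : ∀ᶠ t in F, (nestedBraess j).IsWardropEquilibrium (u t) (g t)) :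
    (nestedBraess j).IsWardropEquilibrium q x := by
  have hge : ∀ e, Tendsto (fun t => g t e) F (𝓝 (x e)) := tendsto_pi_nhds.1 hg
  refine ⟨IsFeasible.of_balance (fun e he => ?_) (fun e => ?_) (fun v => ?_),
    fun c hc => (not_isCycle fst_lt_snd c hc).elim, fun P Q hP hQ hc => ?_⟩
  · exact tendsto_nhds_unique_of_eventuallyEq (hge e) tendsto_const_nhds
      (h.mono fun t ht => ht.feasible.eq_zero e he)
  · exact ge_of_tendsto (hge e) (h.mono fun t ht => ht.feasible.nonneg' e)
  · refine tendsto_nhds_unique_of_eventuallyEq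
      ((tendsto_finsetSum _ fun w _ => hge (w, v)).sub
        (tendsto_finsetSum _ fun w _ => hge (v, w)))
      (Tendsto.sub ?_ ?_) (h.mono fun t ht => ht.feasible.balance v)
    · split_ifs
      exacts [hu, tendsto_const_nhds]
    · split_ifs
      exacts [hu, tendsto_const_nhds]
  · have hev : ∀ᶠ t in F, FlowCarrying (g t) P :=
      (Filter.eventually_all_finite (List.finite_toSet (stepsOf P))).2
        fun e he => (hge e).eventually_const_lt (hc e he)
    exact le_of_tendsto_of_tendsto (((continuous_pathCost P).tendsto x).comp hg)
      (((continuous_pathCost Q).tendsto x).comp hg)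
      ((h.and hev).mono fun t ht => ht.1.path_le P Q hP hQ ht.2)

/-- A function that respects convex combinations on an open interval is affine there. -/
theorem exists_affine_of_combination {ι : Type*} {f : ℝ → ι → ℝ} {a b : ℝ} (hab : a < b)
    (h : ∀ p ∈ Set.Ioo a b, ∀ r ∈ Set.Ioo a b, ∀ α β : ℝ, 0 < α → 0 < β → α + β = 1 →
      f (α * p + β * r) = α • f p + β • f r) :
    ∃ M N : ι → ℝ, ∀ q ∈ Set.Ioo a b, f q = q • M + N := by
  have hlt : ∀ p ∈ Set.Ioo a b, ∀ r ∈ Set.Ioo a b, ∀ q, p < q → q < r → ∀ i,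
      (r - p) * f q i = (r - q) * f p i + (q - p) * f r i := by
    intro p hp r hr q hpq hqr i
    have hpr : 0 < r - p := by linarith
    have h1 := congrFun (h p hp r hr ((r - q) / (r - p)) ((q - p) / (r - p))
      (div_pos (by linarith) hpr) (div_pos (by linarith) hpr) (by field_simp; ring)) i
    rw [show (r - q) / (r - p) * p + (q - p) / (r - p) * r = q by field_simp; ring] at h1
    simp only [Pi.add_apply, Pi.smul_apply, smul_eq_mul] at h1
    rw [h1]
    field_simp
  set p := (2 * a + b) / 3 with hp
  set r := (a + 2 * b) / 3 with hr
  have hpm : p ∈ Set.Ioo a b := ⟨by linarith, by linarith⟩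
  have hrm : r ∈ Set.Ioo a b := ⟨by linarith, by linarith⟩
  have hpr : 0 < r - p := by linarith
  refine ⟨(r - p)⁻¹ • (f r - f p), (r - p)⁻¹ • (r • f p - p • f r), fun q hq => ?_⟩
  funext i
  have hne := hpr.ne'
  have key : (r - p) * f q i = (r - q) * f p i + (q - p) * f r i := by
    -- Outside `[p, r]` the relation is used with `p` or `r` as the middle point.
    rcases lt_trichotomy q p with h1 | h1 | h1
    · linear_combination -hlt q hq r hrm p h1 (by linarith) i
    · rw [h1]
      ring
    · rcases lt_trichotomy q r with h2 | h2 | h2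
      · exact hlt p hpm r hrm q h1 h2 i
      · rw [h2]
        ring
      · linear_combination -hlt p hpm q hq r (by linarith) h2 i
  simp only [Pi.add_apply, Pi.smul_apply, Pi.sub_apply, smul_eq_mul]
  field_simp
  linear_combination key

theorem exists_isBreakpointSet {f : ℝ → Vertex j × Vertex j → ℝ}
    (hf : (nestedBraess j).IsEquilibriumFunction f) : ∃ B, IsBreakpointSet f B := by
  let Q : Set (Vertex j × Vertex j) → Set ℝ :=
    fun S => {q | 0 ≤ q ∧ (nestedBraess j).flowSupport (f q) = S}
  have hcomb : ∀ S, ∀ p ∈ Q S, ∀ r ∈ Q S, ∀ α β : ℝ, 0 < α → 0 < β → α + β = 1 →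
      f (α * p + β * r) = α • f p + β • f r := by
    intro S p hp r hr α β hα hβ hαβ
    have hp0 := hp.1
    have hr0 := hr.1
    exact isWardropEquilibrium_unique (hf _ (by positivity))
      (isWardropEquilibrium_combination hα hβ hαβ (hr.2.trans hp.2.symm) (hf p hp0) (hf r hr0))
  have hord : ∀ S, (Q S).OrdConnected := by
    intro S
    refine Convex.ordConnected (𝕜 := ℝ) (convex_iff_forall_pos.2 ?_)
    intro p hp r hr α β hα hβ hαβ
    have hp0 := hp.1
    have hr0 := hr.1
    refine ⟨by simp only [smul_eq_mul]; positivity, ?_⟩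
    rw [smul_eq_mul, smul_eq_mul, hcomb S p hp r hr α β hα hβ hαβ, ← hp.2]
    ext e
    simp only [flowSupport, Set.mem_ofPred_eq, flowSupport_combination hα hβ.le
      (hr.2.trans hp.2.symm) (hf p hp0).feasible (hf r hr0).feasible e]
  -- The ends of the finitely many support intervals. Default values of `sInf` and `sSup` for empty
  -- or unbounded sets only add harmless breakpoints.
  have hfin : (insert 0 (Set.range (fun S => sInf (Q S)) ∪ Set.range (fun S => sSup (Q S))) ∩
      Set.Ici (0 : ℝ)).Finite :=
    (((Set.finite_range _).union (Set.finite_range _)).insert 0).inter_of_left _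
  refine ⟨hfin.toFinset, by simp, fun b hb => (hfin.mem_toFinset.1 hb).2, fun a b ha hab hB => ?_⟩
  rcases hab.eq_or_lt with rfl | hlt
  · refine ⟨0, f a, fun q hq => ?_⟩
    rw [Set.Icc_self, Set.mem_singleton_iff] at hq
    simp [hq]
  have hno : ∀ t, (t ∈ Set.range (fun S => sInf (Q S)) ∨ t ∈ Set.range (fun S => sSup (Q S))) →
      t ∉ Set.Ioo a b := fun t ht htab =>
    hB t (hfin.mem_toFinset.2 ⟨Or.inr ht, ha.trans htab.1.le⟩) htab
  set c := (a + b) / 2 with hc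
  have hcm : c ∈ Set.Ioo a b := ⟨by linarith, by linarith⟩
  set S := (nestedBraess j).flowSupport (f c) with hS
  have hcS : c ∈ Q S := ⟨ha.trans hcm.1.le, rfl⟩
  -- Otherwise an end of the interval `Q S` would fall between `c` and `q`, hence inside `(a, b)`.
  have hsub : ∀ q ∈ Set.Ioo a b, q ∈ Q S := by
    intro q hq
    by_contra hqS
    rcases le_total c q with hcq | hcq
    · have hub : ∀ r ∈ Q S, r ≤ q := fun r hr => by
        by_contra hrq
        exact hqS ((hord S).out hcS hr ⟨hcq, (not_le.1 hrq).le⟩)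
      exact hno _ (Or.inr ⟨S, rfl⟩) ⟨hcm.1.trans_le (le_csSup ⟨q, hub⟩ hcS),
        (csSup_le ⟨c, hcS⟩ hub).trans_lt hq.2⟩
    · have hlb : ∀ r ∈ Q S, q ≤ r := fun r hr => by
        by_contra hrq
        exact hqS ((hord S).out hr hcS ⟨(not_le.1 hrq).le, hcq⟩)
      exact hno _ (Or.inl ⟨S, rfl⟩) ⟨hq.1.trans_le (le_csInf ⟨c, hcS⟩ hlb),
        (csInf_le ⟨q, hlb⟩ hcS).trans_lt hcm.2⟩
  obtain ⟨M, N, hMN⟩ := exists_affine_of_combination hlt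
    fun p hp r hr => hcomb S p (hsub p hp) r (hsub r hr)
  refine ⟨M, N, fun q hq => ?_⟩
  -- At the endpoints the affine formula is a limit of equilibria, hence the equilibrium by
  -- uniqueness.
  have hcl : q ∈ closure (Set.Ioo a b) := by rwa [closure_Ioo hlt.ne]
  have := mem_closure_iff_nhdsWithin_neBot.1 hcl
  refine isWardropEquilibrium_unique (hf q (ha.trans hq.1))
    (isWardropEquilibrium_of_tendsto (F := 𝓝[Set.Ioo a b] q) (u := id)
      (g := fun t => t • M + N) (tendsto_id.mono_left nhdsWithin_le_nhds) ?_ ?_)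
  · have : Continuous fun t : ℝ => t • M + N := by fun_prop
    exact (this.tendsto q).mono_left nhdsWithin_le_nhds
  · filter_upwards [self_mem_nhdsWithin] with t ht
    rw [← hMN t ht]
    exact hf t (ha.trans ht.1.le)

end PiecewiseLinear

theorem two_pow_le_card_add_one {f : ℝ → Vertex j × Vertex j → ℝ}
    (hf : (nestedBraess j).IsEquilibriumFunction f) {B : Finset ℝ} (hB : IsBreakpointSet f B) :
    2 ^ (j + 1) ≤ B.card + 1 :=
  (two_pow_le_ncard_recurrentSupports j).trans
    (Nat.add_le_add_right (ncard_recurrentSupports_le_card hf hB) 1)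

/-- The empty support, realized at rate 0, joins the recurrent ones to reach `2 ^ (j + 1)`. -/
theorem exists_rates_of_distinct_supports (hj : 1 ≤ j) :
    ∃ q : Fin (2 ^ (j + 1)) → ℝ, Function.Injective q ∧
      (∀ i, q i ∈ Set.Ico (0 : ℝ) (3 * 10 ^ (j - 1))) ∧
      ∀ i k, i ≠ k → ∀ x y, (nestedBraess j).IsWardropEquilibrium (q i) x →
        (nestedBraess j).IsWardropEquilibrium (q k) y →
        (nestedBraess j).flowSupport x ≠ (nestedBraess j).flowSupport y := by
  have hR : (3 : ℝ) * 10 ^ (j - 1) = 3 * 10 ^ j / 10 := by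
    obtain ⟨k, rfl⟩ := Nat.exists_eq_add_of_le' hj
    rw [Nat.add_sub_cancel, pow_succ]
    ring
  have hRpos : (0 : ℝ) < 3 * 10 ^ (j - 1) := by positivity
  have : Fintype ↥(insert ∅ (recurrentSupports j)) := Fintype.ofFinite _
  have hcard : Fintype.card (Fin (2 ^ (j + 1))) ≤
      Fintype.card ↥(insert ∅ (recurrentSupports j)) := by
    rw [Fintype.card_fin, ← Nat.card_eq_fintype_card, Nat.card_coe_set_eq,
      Set.ncard_insert_of_notMem (fun h => Set.not_nonempty_empty h.1) (Set.toFinite _)]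
    exact two_pow_le_ncard_recurrentSupports j
  obtain ⟨φ⟩ := Function.Embedding.nonempty_of_card_le hcard
  have h : ∀ i, ∃ q ∈ Set.Ico (0 : ℝ) (3 * 10 ^ (j - 1)), ∃ x,
      (nestedBraess j).IsWardropEquilibrium q x ∧ (nestedBraess j).flowSupport x = φ i := by
    intro i
    rcases (φ i).2 with h | h
    · exact ⟨0, ⟨le_rfl, hRpos⟩, 0, (isEquilibriumWith_zero_flow j le_rfl).isWardropEquilibrium,
        by simp [flowSupport, h]⟩
    · obtain ⟨q, h0, hq, l, x, hx, hxs⟩ := h.2.nonempty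
      exact ⟨q, ⟨h0.le, hR ▸ hq⟩, x, hx.isWardropEquilibrium, hxs⟩
  choose q hq x hx hxs using h
  have hne : ∀ i k, i ≠ k → ∀ y z, (nestedBraess j).IsWardropEquilibrium (q i) y →
      (nestedBraess j).IsWardropEquilibrium (q k) z →
      (nestedBraess j).flowSupport y ≠ (nestedBraess j).flowSupport z := by
    intro i k hik y z hy hz heq
    rw [isWardropEquilibrium_unique hy (hx i), isWardropEquilibrium_unique hz (hx k), hxs, hxs]
      at heq
    exact hik (φ.injective (Subtype.ext heq))
  refine ⟨q, fun i k hik => ?_, hq, hne⟩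
  by_contra hne'
  exact hne i k hne' (x i) (x i) (hx i) (hik ▸ hx i) rfl

end NestedBraess

theorem mainTheorem11 :
    (∀ j : ℕ, 1 ≤ j →
      Fintype.card (NestedBraess.Vertex j) = 2 * j + 2 ∧
      (nestedBraess j).edges.card = 4 * j + 1 ∧
      -- the equilibrium exists and is unique for every demand rate
      (∀ q : ℝ, 0 ≤ q → ∃! x, (nestedBraess j).IsWardropEquilibrium q x) ∧
      -- demand rates with pairwise different support sets
      (∃ q : Fin (2 ^ (j + 1)) → ℝ, Function.Injective q ∧
        (∀ i, q i ∈ Set.Ico (0 : ℝ) (3 * 10 ^ (j - 1))) ∧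
        ∀ i k, i ≠ k → ∀ x y,
          (nestedBraess j).IsWardropEquilibrium (q i) x →
          (nestedBraess j).IsWardropEquilibrium (q k) y →
          (nestedBraess j).flowSupport x ≠ (nestedBraess j).flowSupport y) ∧
      -- the equilibrium function is piecewise linear with at least `2 ^ (j + 1) - 1` parts
      (∀ f, (nestedBraess j).IsEquilibriumFunction f →
        (∃ B, IsBreakpointSet f B) ∧
        ∀ B, IsBreakpointSet f B → 2 ^ (j + 1) ≤ B.card + 1)) ∧
    -- the number of parts is exponential in the number of vertices and edges
    (∃ c : ℝ, 1 < c ∧ ∀ j : ℕ, 1 ≤ j → ∀ f, (nestedBraess j).IsEquilibriumFunction f →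
      ∀ B, IsBreakpointSet f B →
        c ^ (Fintype.card (NestedBraess.Vertex j) + (nestedBraess j).edges.card) ≤ (B.card : ℝ)) := by
  refine ⟨fun j hj => ⟨Fintype.card_fin _, NestedBraess.card_edges j,
    fun q hq => NestedBraess.existsUnique_isWardropEquilibrium j hq,
    NestedBraess.exists_rates_of_distinct_supports hj,
    fun f hf => ⟨NestedBraess.exists_isBreakpointSet hf,
      fun B hB => NestedBraess.two_pow_le_card_add_one hf hB⟩⟩,
    -- For `j ≥ 1` the size `6j + 3` is at most `9j`, and `(21 / 20) ^ 9 ≤ 2`.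
    21 / 20, by norm_num, fun j hj f hf B hB => ?_⟩
  have h1 : (2 : ℝ) ^ j ≤ B.card := by
    have h := NestedBraess.two_pow_le_card_add_one hf hB
    have h2 : 1 ≤ 2 ^ j := Nat.one_le_two_pow
    rw [pow_succ] at h
    exact_mod_cast (by omega : 2 ^ j ≤ B.card)
  refine le_trans ?_ h1
  rw [Fintype.card_fin, NestedBraess.card_edges]
  calc (21 / 20 : ℝ) ^ (2 * j + 2 + (4 * j + 1)) ≤ (21 / 20) ^ (9 * j) :=
        pow_le_pow_right₀ (by norm_num) (by omega)
    _ = ((21 / 20) ^ 9) ^ j := pow_mul _ _ _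
    _ ≤ 2 ^ j := pow_le_pow_left₀ (by norm_num) (by norm_num) j
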